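/- Let $d\geq 2$ and $n\geq 2$, and let $M$ be a (non-empty) connected topological manifold of dimension $d$ without boundary. Let $B(M,n)=F(M,n)/\mathfrak S_n$ be the unordered configuration space of $n$ points of $M$, where $F(M,n)=\{(x_1,\dots,x_n)\in M^n : x_i\neq x_j \text{ for } i\neq j\}$ has the subspace topology, the symmetric group $\mathfrak S_n$ permutes the coordinates, and $B(M,n)$ has the quotient topology; it is a manifold of dimension $nd$. Then $B(M,n)$ is orientable if and only if $M$ is orientable and $d$ is even. Here a topological manifold of dimension $m$ is called orientable if it is covered by charts (homeomorphisms from open subsets onto open subsets of $\mathbb R^m$) all of whose transition maps have local degree $+1$ at every point. -/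

import Mathlib

open scoped ContDiff

/-! ### The Brouwer degree and orientation-preserving local homeomorphisms -/

/-- `HasBrouwerDegree f U y k`: the Brouwer degree of `f` on the bounded open set `U` over the
point `y` is `k` (for `f` continuous on `closure U` and `y ∉ f '' frontier U`).
As usual, the degree is computed by counting, with the sign of the Jacobian determinant, the
preimages of `y` in `U` under a smooth map `g` for which `y` is a regular value on `U` and which
is closer to `f` on `closure U` than `y` is to `f '' frontier U`. -/
def HasBrouwerDegree {E : Type*} [NormedAddCommGroup E] [NormedSpace ℝ E]
    (f : E → E) (U : Set E) (y : E) (k : ℤ) : Prop :=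
  ∃ g : E → E, ContDiff ℝ ∞ g ∧
    (∀ x ∈ closure U, ∀ z ∈ frontier U, dist (g x) (f x) < dist y (f z)) ∧
    (∀ x ∈ U, g x = y → (fderiv ℝ g x).det ≠ 0) ∧
    (∑ᶠ x ∈ {x | x ∈ U ∧ g x = y}, ((SignType.sign (fderiv ℝ g x).det : SignType) : ℤ)) = k

/-- The local homeomorphism `e` preserves orientation at the point `x` of its source: its local
degree at `x`, that is, its Brouwer degree on a ball around `x` over `e x`, equals `1`. (Since `e`
is injective on its source, the choice of the ball is immaterial.) -/
def OpenPartialHomeomorph.PreservesOrientationAt {E : Type*} [NormedAddCommGroup E]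
    [NormedSpace ℝ E] (e : OpenPartialHomeomorph E E) (x : E) : Prop :=
  ∃ r : ℝ, 0 < r ∧ Metric.closedBall x r ⊆ e.source ∧
    HasBrouwerDegree e (Metric.ball x r) (e x) 1

/-- Orientability of a topological manifold `X` of dimension `d` (without boundary): there is a
family of charts covering `X`, all of whose transition maps preserve orientation. The charts are
arbitrary homeomorphisms from open subsets of `X` to open subsets of `ℝᵈ`. -/
def IsOrientableManifold (d : ℕ) (X : Type*) [TopologicalSpace X] : Prop :=
  ∃ A : Set (OpenPartialHomeomorph X (EuclideanSpace ℝ (Fin d))),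
    (∀ x : X, ∃ e ∈ A, x ∈ e.source) ∧
    ∀ e ∈ A, ∀ e' ∈ A, ∀ p ∈ (e.symm.trans e').source,
      (e.symm.trans e').PreservesOrientationAt p

/-! ### Configuration spaces -/

/-- The ordered configuration space `F(M, n)`: `n`-tuples of pairwise distinct points of `M`, as a
subspace of `Mⁿ`. -/
abbrev OrderedConf (M : Type*) (n : ℕ) : Type _ :=
  {x : Fin n → M // Function.Injective x}

/-- Two ordered configurations are equivalent if they differ by a permutation of the indices. -/
def OrderedConf.setoid (M : Type*) (n : ℕ) : Setoid (OrderedConf M n) where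
  r x y := ∃ σ : Equiv.Perm (Fin n), ∀ i, y.1 i = x.1 (σ i)
  iseqv :=
    { refl := fun _ => ⟨1, fun _ => rfl⟩
      symm := fun {x y} ⟨σ, h⟩ => ⟨σ⁻¹, fun i => by simp [h]⟩
      trans := fun {x y z} ⟨σ, h⟩ ⟨τ, k⟩ => ⟨σ * τ, fun i => by simp [h, k]⟩ }

/-- The unordered configuration space (braid space) `B(M, n) = F(M, n) / 𝔖ₙ`. -/
def BraidSpace (M : Type*) (n : ℕ) : Type _ :=
  Quotient (OrderedConf.setoid M n)

/-- The quotient topology on `B(M, n) = F(M, n) / 𝔖ₙ`. -/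
instance BraidSpace.instTopologicalSpace (M : Type*) [TopologicalSpace M] (n : ℕ) :
    TopologicalSpace (BraidSpace M n) :=
  inferInstanceAs (TopologicalSpace (Quotient (OrderedConf.setoid M n)))

/-! The projection F(M, n) → B(M, n) is a local homeomorphism, so a product of n charts of M,
composed with a local inverse of the projection, is a chart of B(M, n). Comparing two such charts
involves only products of transition maps of M, whose local degree is the product of those of the
factors (`localDegree_blockMap`), and permutations σ of the n blocks of ℝⁿᵈ, of local degree
sign(σ)ᵈ (`localDegree_blockPerm`). If M is oriented and d is even, all these signs are +1 and B(M,
n) is oriented.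

Conversely, an orientation of B(M, n) pulls back to a locally constant sign on product charts around
ordered configurations, which changes by sign(σ)ᵈ under relabelling (`ConfOrientation`). Inside one
chart, let two points run through antipodal pairs of the unit sphere. The sphere is connected since
d ≥ 2, so the sign is the same before and after the two points are exchanged, while the
transposition multiplies it by (-1)ᵈ; hence d is even. Freezing all points but one orients M away
from finitely many points. This orientation extends across them, because a punctured ℝᵈ is connected
and local degrees are locally constant.

What remains is that the local degree of a homeomorphism germ is well defined, locally constant,
multiplicative, and compatible with products. `HasBrouwerDegree` only provides a signed count for
some smooth approximation, so even uniqueness needs an argument. It comes from the integral of ρ(g)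
det Dg. Along a homotopy of g, the derivative of this integrand is a divergence, so the integral
does not change as long as the boundary stays away from the support of ρ
(`setIntegral_jacobian_eq_of_line`). By change of variables it is the signed count when ρ is
concentrated near a regular value. `HasBrouwerDegree.setIntegral_eq` expresses the degree by such
integrals; excision and multiplicativity then reduce to shrinking the domain of an integral and to
the chain rule for determinants. -/

open MeasureTheory Set Filter Topology
set_option linter.unusedSectionVars false

/-! ### Homotopy invariance of the degree integral -/

section Jacobian

variable {E : Type*} [NormedAddCommGroup E] [NormedSpace ℝ E] [FiniteDimensional ℝ E]
variable {ι : Type*} [Fintype ι] [DecidableEq ι]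

/-- Cramer's rule in coordinate-free form. -/
theorem Module.Basis.sum_det_update_smul (b : Module.Basis ι ℝ E) (v : ι → E) (w : E) :
    ∑ j, b.det (Function.update v j w) • v j = b.det v • w := by
  apply b.repr.injective
  ext i
  have h := congrFun (Matrix.mulVec_cramer (b.toMatrix v) (b.repr w)) i
  have hc : ∀ j, Matrix.cramer (b.toMatrix v) (b.repr w) j = b.det (Function.update v j w) := by
    intro j
    rw [Matrix.cramer_apply, b.det_apply, b.toMatrix_update]
  simp only [Matrix.mulVec, dotProduct, hc, Module.Basis.toMatrix_apply, Pi.smul_apply,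
    smul_eq_mul] at h
  simp only [map_sum, map_smul, Finsupp.coe_finsetSum, Finset.sum_apply, Finsupp.coe_smul,
    Pi.smul_apply, smul_eq_mul, b.det_apply] at h ⊢
  rw [← h]
  exact Finset.sum_congr rfl fun j _ => mul_comm _ _

theorem Module.Basis.sum_mul_det_update (b : Module.Basis ι ℝ E) (l : E →L[ℝ] ℝ) (v : ι → E)
    (w : E) : ∑ j, l (v j) * b.det (Function.update v j w) = l w * b.det v := by
  have h := congrArg l (b.sum_det_update_smul v w)
  simp only [map_sum, map_smul, smul_eq_mul] at h
  rw [mul_comm (l w), ← h]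
  exact Finset.sum_congr rfl fun j _ => mul_comm _ _

/-- Exchanging j and k swaps two arguments of an alternating map, so the terms cancel in pairs. With
H the second derivative of u, this is the Piola identity: the rows of the cofactor matrix of Du are
divergence free. -/
theorem AlternatingMap.sum_update_update_eq_zero (D : E [⋀^ι]→ₗ[ℝ] ℝ) (v : ι → E) (w : E)
    (H : ι → ι → E) (hH : ∀ j k, H j k = H k j) :
    ∑ j, ∑ k ∈ Finset.univ.erase j, D (Function.update (Function.update v j w) k (H j k)) = 0 := by
  set T : ι → ι → ℝ := fun j k =>
    if k = j then 0 else D (Function.update (Function.update v j w) k (H j k)) with hT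
  have h1 : ∀ j, ∑ k ∈ Finset.univ.erase j,
      D (Function.update (Function.update v j w) k (H j k)) = ∑ k, T j k := by
    intro j
    rw [← Finset.add_sum_erase Finset.univ (T j) (Finset.mem_univ j)]
    have : T j j = 0 := by simp [hT]
    rw [this, zero_add]
    refine Finset.sum_congr rfl fun k hk => ?_
    simp [hT, Finset.ne_of_mem_erase hk]
  have h2 : ∀ j k, T j k = - T k j := by
    intro j k
    rcases eq_or_ne k j with rfl | hkj
    · simp [hT]
    · simp only [hT, hkj, hkj.symm, if_false]
      rw [← D.map_swap _ hkj.symm, hH k j]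
      congr 1
      ext i
      rcases eq_or_ne i j with rfl | hij
      · simp [Function.update_of_ne, hkj.symm, hkj]
      rcases eq_or_ne i k with rfl | hik
      · simp
      simp [Function.update_of_ne, hij, hik, Equiv.swap_apply_of_ne_of_ne hij hik]
  simp only [h1]
  have h3 : ∑ j, ∑ k, T j k = - ∑ j, ∑ k, T j k := by
    conv_lhs => rw [Finset.sum_comm]
    rw [← Finset.sum_neg_distrib]
    refine Finset.sum_congr rfl fun j _ => ?_
    rw [← Finset.sum_neg_distrib]
    exact Finset.sum_congr rfl fun k _ => h2 _ _
  linarith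

/-- The determinant with respect to a basis, as a continuous multilinear map. -/
noncomputable def Module.Basis.detCM (b : Module.Basis ι ℝ E) :
    ContinuousMultilinearMap ℝ (fun _ : ι => E) ℝ where
  toMultilinearMap := b.det.toMultilinearMap
  cont := by
    change Continuous fun v => b.det v
    simp only [b.det_apply]
    refine Continuous.matrix_det (continuous_matrix fun i j => ?_)
    simp only [Module.Basis.toMatrix_apply]
    exact (b.coord i).continuous_of_finiteDimensional.comp (continuous_apply j)

theorem Module.Basis.detCM_apply (b : Module.Basis ι ℝ E) (v : ι → E) : b.detCM v = b.det v := rfl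

theorem Module.Basis.det_clm (b : Module.Basis ι ℝ E) (A : E →L[ℝ] E) :
    A.det = b.det (fun j => A (b j)) := by
  have := b.det_comp (A : E →ₗ[ℝ] E) b
  rw [b.det_self, mul_one] at this
  exact this.symm

/-- The vector field whose divergence is the variation of `ρ(u) det Du` in the direction `h`. -/
noncomputable def variationField (b : Module.Basis ι ℝ E) (ρ : E → ℝ) (u h : E → E) (j : ι)
    (x : E) : ℝ :=
  ρ (u x) * b.det (Function.update (fun k => fderiv ℝ u x (b k)) j (h x))

theorem contDiff_fderiv_apply_const {F : Type*} [NormedAddCommGroup F] [NormedSpace ℝ F]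
    {u : E → F} (hu : ContDiff ℝ ∞ u) (v : E) :
    ContDiff ℝ ∞ fun x => fderiv ℝ u x v :=
  (hu.fderiv_right (m := ∞) (by simp)).clm_apply contDiff_const

theorem contDiff_update_frame (b : Module.Basis ι ℝ E) {u h : E → E} (hu : ContDiff ℝ ∞ u)
    (hh : ContDiff ℝ ∞ h) (j i : ι) : ContDiff ℝ ∞ fun x =>
      Function.update (fun k => fderiv ℝ u x (b k)) j (h x) i := by
  rcases eq_or_ne i j with rfl | hij
  · simpa using hh
  · simpa [Function.update_of_ne hij] using contDiff_fderiv_apply_const hu (b i)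

theorem contDiff_variationField (b : Module.Basis ι ℝ E) {ρ : E → ℝ} {u h : E → E}
    (hρ : ContDiff ℝ ∞ ρ) (hu : ContDiff ℝ ∞ u) (hh : ContDiff ℝ ∞ h) (j : ι) :
    ContDiff ℝ ∞ (variationField b ρ u h j) := by
  refine (hρ.comp hu).mul ?_
  exact b.detCM.contDiff.comp (contDiff_pi.2 fun i => contDiff_update_frame b hu hh j i)

/-- The variation of the integrand `ρ(u) det Du` in the direction `h`. -/
noncomputable def jacobianVariation (b : Module.Basis ι ℝ E) (ρ : E → ℝ) (u h : E → E)
    (x : E) : ℝ :=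
  fderiv ℝ ρ (u x) (h x) * b.det (fun k => fderiv ℝ u x (b k)) +
    ρ (u x) * ∑ j, b.det (Function.update (fun k => fderiv ℝ u x (b k)) j (fderiv ℝ h x (b j)))

/-- The product rule gives three kinds of terms. Those differentiating ρ(u) recombine by Cramer's
rule, those differentiating h are kept, and those containing second derivatives of u cancel by
symmetry of D²u. -/
theorem sum_fderiv_variationField (b : Module.Basis ι ℝ E) {ρ : E → ℝ} {u h : E → E}
    (hρ : ContDiff ℝ ∞ ρ) (hu : ContDiff ℝ ∞ u) (hh : ContDiff ℝ ∞ h) (x : E) :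
    ∑ j, fderiv ℝ (variationField b ρ u h j) x (b j) = jacobianVariation b ρ u h x := by
  have hdr : HasFDerivAt (fun x => ρ (u x)) ((fderiv ℝ ρ (u x)).comp (fderiv ℝ u x)) x :=
    ((hρ.differentiable (by simp)) (u x)).hasFDerivAt.comp x
      ((hu.differentiable (by simp)) x).hasFDerivAt
  have hdet : ∀ j, HasFDerivAt
      (fun x => b.detCM fun i => Function.update (fun k => fderiv ℝ u x (b k)) j (h x) i) _ x :=
    fun j => HasFDerivAt.multilinear_comp b.detCM fun i =>
      (((contDiff_update_frame b hu hh j i).differentiable (by simp)) x).hasFDerivAt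
  have key : ∀ j, fderiv ℝ (variationField b ρ u h j) x (b j) =
      fderiv ℝ ρ (u x) (fderiv ℝ u x (b j)) *
        b.det (Function.update (fun k => fderiv ℝ u x (b k)) j (h x)) +
      ρ (u x) * (b.det (Function.update (fun k => fderiv ℝ u x (b k)) j (fderiv ℝ h x (b j))) +
        ∑ k ∈ Finset.univ.erase j, b.det (Function.update
          (Function.update (fun k => fderiv ℝ u x (b k)) j (h x)) k
          (fderiv ℝ (fderiv ℝ u) x (b j) (b k)))) := by
    intro j
    have := (hdr.mul (hdet j)).fderiv
    change fderiv ℝ (variationField b ρ u h j) x = _ at this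
    rw [this]
    simp only [add_apply, smul_apply, sum_apply,
      ContinuousLinearMap.comp_apply, smul_eq_mul,
      ContinuousMultilinearMap.toContinuousLinearMap_apply]
    rw [← Finset.add_sum_erase Finset.univ _ (Finset.mem_univ j), add_comm, mul_comm]
    have e1 : (fun x => Function.update (fun k => fderiv ℝ u x (b k)) j (h x) j) = h := by
      ext; simp
    congr 2
    congr 1
    · rw [e1, Module.Basis.detCM_apply, Function.update_idem]
    · refine Finset.sum_congr rfl fun k hk => ?_
      have hkj := Finset.ne_of_mem_erase hk
      have e2 : (fun x => Function.update (fun k => fderiv ℝ u x (b k)) j (h x) k) =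
        fun x => fderiv ℝ u x (b k) := by
        ext; simp [Function.update_of_ne hkj]
      rw [e2, Module.Basis.detCM_apply]
      have : HasFDerivAt (fun x => fderiv ℝ u x (b k))
          ((fderiv ℝ (fderiv ℝ u) x).flip (b k)) x := by
        have h1 := (((hu.fderiv_right (m := ∞) (by simp)).differentiable (by simp)) x).hasFDerivAt
        exact (ContinuousLinearMap.apply ℝ E (b k)).hasFDerivAt.comp x h1
      rw [this.fderiv]
      rfl
  simp only [key, Finset.sum_add_distrib, ← Finset.mul_sum]
  rw [AlternatingMap.sum_update_update_eq_zero b.det, add_zero, b.sum_mul_det_update]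
  · rfl
  · intro j k
    exact ((contDiff_infty.1 hu 2).contDiffAt.isSymmSndFDerivAt (by simp)).eq _ _

theorem fderiv_line_apply {g h : E → E} (hg : ContDiff ℝ ∞ g) (hh : ContDiff ℝ ∞ h) (x : E)
    (t : ℝ) (v : E) : fderiv ℝ (fun y => g y + t • h y) x v =
      fderiv ℝ g x v + t • fderiv ℝ h x v := by
  have h1 := ((hg.differentiable (by simp)) x).hasFDerivAt
  have h2 := ((hh.differentiable (by simp)) x).hasFDerivAt
  have h3 := (h1.add (h2.const_smul t)).fderiv
  change fderiv ℝ (fun y => g y + t • h y) x = _ at h3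
  rw [h3]
  rfl

theorem hasDerivAt_jacobian_line (b : Module.Basis ι ℝ E) {ρ : E → ℝ} {g h : E → E}
    (hρ : ContDiff ℝ ∞ ρ) (hg : ContDiff ℝ ∞ g) (hh : ContDiff ℝ ∞ h) (x : E) (t : ℝ) :
    HasDerivAt (fun t : ℝ => ρ (g x + t • h x) * (fderiv ℝ (fun y => g y + t • h y) x).det)
      (jacobianVariation b ρ (fun y => g y + t • h y) h x) t := by
  have hline : ∀ a c : E, HasDerivAt (fun t : ℝ => a + t • c) c t := by
    intro a c
    simpa using ((hasDerivAt_id t).smul_const c).const_add a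
  have h1 : HasDerivAt (fun t : ℝ => ρ (g x + t • h x))
      (fderiv ℝ ρ (g x + t • h x) (h x)) t :=
    ((hρ.differentiable (by simp)) _).hasFDerivAt.comp_hasDerivAt t (hline _ _)
  have h2 : HasDerivAt (fun t : ℝ => b.detCM fun k => fderiv ℝ g x (b k) + t • fderiv ℝ h x (b k))
      (∑ j, b.det (Function.update (fun k => fderiv ℝ g x (b k) + t • fderiv ℝ h x (b k)) j
        (fderiv ℝ h x (b j)))) t := by
    have := (HasFDerivAt.multilinear_comp b.detCM fun k =>
      (hline (fderiv ℝ g x (b k)) (fderiv ℝ h x (b k))).hasFDerivAt).hasDerivAt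
    refine this.congr_deriv ?_
    simp [Module.Basis.detCM_apply]
  have h3 := h1.mul h2
  simp only [b.det_clm, jacobianVariation, fderiv_line_apply hg hh]
  refine h3.congr_deriv ?_
  simp only [Module.Basis.detCM_apply]

theorem continuous_jacobianVariation_line (b : Module.Basis ι ℝ E) {ρ : E → ℝ} {g h : E → E}
    (hρ : ContDiff ℝ ∞ ρ) (hg : ContDiff ℝ ∞ g) (hh : ContDiff ℝ ∞ h) :
    Continuous fun p : ℝ × E => jacobianVariation b ρ (fun y => g y + p.1 • h y) h p.2 := by
  simp only [jacobianVariation, fderiv_line_apply hg hh]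
  have hgc := hg.continuous
  have hhc := hh.continuous
  have hρc := hρ.continuous
  have h1 : Continuous (fderiv ℝ ρ) := hρ.continuous_fderiv (by simp)
  have h2 : ∀ v, Continuous fun x => fderiv ℝ g x v :=
    fun v => (contDiff_fderiv_apply_const hg v).continuous
  have h3 : ∀ v, Continuous fun x => fderiv ℝ h x v :=
    fun v => (contDiff_fderiv_apply_const hh v).continuous
  have h4 : ∀ v, Continuous fun p : ℝ × E => fderiv ℝ g p.2 v + p.1 • fderiv ℝ h p.2 v :=
    fun v => ((h2 v).comp continuous_snd).add (continuous_fst.smul ((h3 v).comp continuous_snd))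
  have hl : Continuous fun p : ℝ × E => g p.2 + p.1 • h p.2 := by fun_prop
  refine ((((h1.comp hl).clm_apply (hhc.comp continuous_snd))).mul
    (b.detCM.cont.comp (continuous_pi fun k => h4 (b k)))).add
    ((hρc.comp hl).mul (continuous_finsetSum _ fun j _ =>
      b.detCM.cont.comp (continuous_pi fun k => ?_)))
  rcases eq_or_ne k j with rfl | hkj
  · simpa [Function.comp_def] using (h3 (b k)).comp continuous_snd
  · simpa [Function.update_of_ne hkj] using h4 (b k)

theorem continuous_det_fderiv {g : E → E} (hg : ContDiff ℝ ∞ g) :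
    Continuous fun x => (fderiv ℝ g x).det :=
  ContinuousLinearMap.continuous_det.comp (hg.continuous_fderiv (by simp))

variable [MeasureSpace E] [BorelSpace E] [(volume : Measure E).IsAddHaarMeasure]

/-- The variation is a divergence, so integration by parts moves the derivative onto χ. The
resulting integrand vanishes because ρ(u) is zero wherever Dχ is not. -/
theorem integral_mul_jacobianVariation (b : Module.Basis ι ℝ E) {χ ρ : E → ℝ} {u h : E → E}
    (hχ : ContDiff ℝ ∞ χ) (hχc : HasCompactSupport χ) (hρ : ContDiff ℝ ∞ ρ)
    (hu : ContDiff ℝ ∞ u) (hh : ContDiff ℝ ∞ h)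
    (h0 : ∀ x, fderiv ℝ χ x ≠ 0 → ρ (u x) = 0) :
    ∫ x, χ x * jacobianVariation b ρ u h x = 0 := by
  have hX := fun j => contDiff_variationField b hρ hu hh j
  have hXd : ∀ j, Continuous fun x => fderiv ℝ (variationField b ρ u h j) x (b j) :=
    fun j => ((hX j).continuous_fderiv (by simp)).clm_apply continuous_const
  have i1 : ∀ j, Integrable fun x => χ x * fderiv ℝ (variationField b ρ u h j) x (b j) :=
    fun j => (hχ.continuous.mul (hXd j)).integrable_of_hasCompactSupport hχc.mul_right
  simp only [← sum_fderiv_variationField b hρ hu hh, Finset.mul_sum]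
  rw [integral_finsetSum _ fun j _ => i1 j]
  refine Finset.sum_eq_zero fun j _ => ?_
  rw [integral_mul_fderiv_eq_neg_fderiv_mul_of_integrable]
  · rw [neg_eq_zero]
    refine integral_eq_zero_of_ae (Eventually.of_forall fun x => ?_)
    by_cases hx : fderiv ℝ χ x = 0
    · simp [hx]
    · simp [variationField, h0 x hx]
  · have hc : Continuous fun x => fderiv ℝ χ x (b j) :=
      (hχ.continuous_fderiv (by simp)).clm_apply continuous_const
    refine (hc.mul (hX j).continuous).integrable_of_hasCompactSupport ?_
    exact (HasCompactSupport.fderiv_apply (𝕜 := ℝ) hχc (b j)).mul_right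
  · exact i1 j
  · exact (hχ.continuous.mul (hX j).continuous).integrable_of_hasCompactSupport hχc.mul_right
  · exact fun x _ => hχ.differentiable (by simp) x
  · exact fun x _ => (hX j).differentiable (by simp) x

/-- Homotopy invariance of the cut-off degree integral. -/
theorem integral_cutoff_mul_jacobian_eq {χ ρ : E → ℝ} {g h : E → E}
    (hχ : ContDiff ℝ ∞ χ) (hχc : HasCompactSupport χ) (hρ : ContDiff ℝ ∞ ρ)
    (hg : ContDiff ℝ ∞ g) (hh : ContDiff ℝ ∞ h)
    (h0 : ∀ t ∈ Icc (0 : ℝ) 1, ∀ x, fderiv ℝ χ x ≠ 0 → ρ (g x + t • h x) = 0) :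
    ∫ x, χ x * (ρ (g x + h x) * (fderiv ℝ (fun y => g y + h y) x).det) =
      ∫ x, χ x * (ρ (g x) * (fderiv ℝ g x).det) := by
  classical
  let b := Module.finBasis ℝ E
  set F : ℝ → E → ℝ := fun t x =>
    χ x * (ρ (g x + t • h x) * (fderiv ℝ (fun y => g y + t • h y) x).det) with hF
  have hsm : ∀ t : ℝ, ContDiff ℝ ∞ fun y => g y + t • h y := fun t => hg.add (hh.const_smul t)
  have hFc : ∀ t, Continuous (F t) := fun t =>
    hχ.continuous.mul ((hρ.continuous.comp (hsm t).continuous).mul (continuous_det_fderiv (hsm t)))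
  have hjc := continuous_jacobianVariation_line b hρ hg hh
  have hder : ∀ t ∈ Icc (0 : ℝ) 1, HasDerivAt (fun t => ∫ x, F t x) 0 t := by
    intro t ht
    obtain ⟨C, hC⟩ := ((isCompact_closedBall t 1).prod hχc.isCompact).exists_bound_of_continuousOn
      (f := fun p : ℝ × E => χ p.2 * jacobianVariation b ρ (fun y => g y + p.1 • h y) h p.2)
      ((hχ.continuous.comp continuous_snd).mul hjc).continuousOn
    -- Differentiation under the integral sign: the derivative in t is bounded by the constant C on
    -- the support of χ, by compactness of that support times a time interval.
    have := (hasDerivAt_integral_of_dominated_loc_of_deriv_le (μ := (volume : Measure E))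
      (F := F) (x₀ := t) (s := Metric.closedBall t 1)
      (F' := fun t x => χ x * jacobianVariation b ρ (fun y => g y + t • h y) h x)
      (bound := (tsupport χ).indicator fun _ => C)
      (Metric.closedBall_mem_nhds _ one_pos)
      (Eventually.of_forall fun t => (hFc t).aestronglyMeasurable)
      ((hFc t).integrable_of_hasCompactSupport hχc.mul_right)
      (hχ.continuous.mul (hjc.comp (Continuous.prodMk_right t))).aestronglyMeasurable
      (Eventually.of_forall fun x s hs => ?_)
      ((integrable_indicator_iff (isClosed_tsupport χ).measurableSet).2
        (integrableOn_const hχc.isCompact.measure_lt_top.ne))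
      (Eventually.of_forall fun x s hs => ?_)).2
    · rwa [integral_mul_jacobianVariation b hχ hχc hρ (hsm t) hh (h0 t ht)] at this
    · by_cases hx : x ∈ tsupport χ
      · rw [indicator_of_mem hx]
        exact hC (s, x) ⟨hs, hx⟩
      · rw [indicator_of_notMem hx, image_eq_zero_of_notMem_tsupport hx]
        simp
    · exact (hasDerivAt_jacobian_line b hρ hg hh x s).const_mul (χ x)
  have := constant_of_has_deriv_right_zero (f := fun t => ∫ x, F t x) (a := 0) (b := 1)
    (fun t ht => (hder t ht).continuousAt.continuousWithinAt)
    (fun t ht => (hder t ⟨ht.1, ht.2.le⟩).hasDerivWithinAt) 1 (by simp)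
  simpa [hF] using this

/-- Homotopy invariance of the degree integral over a bounded open set. -/
theorem setIntegral_jacobian_eq_of_line {U : Set E} (hU : IsOpen U) (hUb : Bornology.IsBounded U)
    {ρ : E → ℝ} {g h : E → E} (hρ : ContDiff ℝ ∞ ρ) (hg : ContDiff ℝ ∞ g) (hh : ContDiff ℝ ∞ h)
    (h0 : ∀ t ∈ Icc (0 : ℝ) 1, ∀ x ∈ frontier U, g x + t • h x ∉ tsupport ρ) :
    ∫ x in U, ρ (g x + h x) * (fderiv ℝ (fun y => g y + h y) x).det =
      ∫ x in U, ρ (g x) * (fderiv ℝ g x).det := by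
  have hcl : IsCompact (closure U) := hUb.isCompact_closure
  -- K collects the points of the closure of U that some stage of the homotopy sends into the
  -- support of ρ. It is compact, and it lies in the open set U because the frontier never reaches
  -- that support. A cutoff equal to 1 near K and supported in U therefore leaves the integrals
  -- unchanged.
  set K : Set E := Prod.snd '' ((Icc (0 : ℝ) 1 ×ˢ closure U) ∩
    (fun p : ℝ × E => g p.2 + p.1 • h p.2) ⁻¹' tsupport ρ) with hK
  have hgc := hg.continuous
  have hhc := hh.continuous
  have hKc : IsCompact K := by
    refine IsCompact.image ?_ continuous_snd
    exact (isCompact_Icc.prod hcl).inter_right ((isClosed_tsupport ρ).preimage (by fun_prop))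
  have hKU : K ⊆ U := by
    rintro _ ⟨⟨t, x⟩, ⟨⟨ht, hx⟩, hxt⟩, rfl⟩
    by_contra hxU
    exact h0 t ht x (by rw [hU.frontier_eq]; exact ⟨hx, hxU⟩) hxt
  have hmem : ∀ t ∈ Icc (0 : ℝ) 1, ∀ x ∈ closure U, ρ (g x + t • h x) ≠ 0 → x ∈ K :=
    fun t ht x hx hne => ⟨(t, x), ⟨⟨ht, hx⟩, subset_tsupport _ hne⟩, rfl⟩
  obtain ⟨L, hL, hKL, hLU⟩ := exists_compact_between hKc hU hKU
  obtain ⟨χ, hχ1, hχ0, -⟩ := exists_contMDiffMap_one_nhds_of_subset_interior (n := ⊤)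
    (modelWithCornersSelf ℝ E) hKc.isClosed hKL
  have hχ : ContDiff ℝ ∞ χ := χ.contMDiff.contDiff
  have hχs : tsupport χ ⊆ L :=
    closure_minimal (fun x hx => by by_contra hxL; exact hx (hχ0 x hxL)) hL.isClosed
  have hχc : HasCompactSupport χ := hL.of_isClosed_subset (isClosed_tsupport _) hχs
  have hχz : ∀ x ∉ U, χ x = 0 := fun x hx => hχ0 x fun h => hx (hLU h)
  have key := integral_cutoff_mul_jacobian_eq hχ hχc hρ hg hh ?_
  · have aux : ∀ (u : E → E) (w : E → ℝ), (∀ x ∈ closure U, ρ (u x) ≠ 0 → x ∈ K) →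
        ∫ x, χ x * (ρ (u x) * w x) = ∫ x in U, ρ (u x) * w x := by
      intro u w hu
      rw [← integral_indicator hU.measurableSet]
      congr 1
      ext x
      by_cases hx : x ∈ U
      · rw [indicator_of_mem hx]
        by_cases hr : ρ (u x) = 0
        · simp [hr]
        · rw [(hχ1.self_of_nhdsSet) x (hu x (subset_closure hx) hr), one_mul]
      · rw [indicator_of_notMem hx, hχz x hx, zero_mul]
    rw [aux (fun x => g x + h x), aux g] at key
    · exact key
    · intro x hx hne
      exact hmem 0 (by simp) x hx (by simpa using hne)
    · intro x hx hne
      exact hmem 1 (by simp) x hx (by simpa using hne)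
  -- Where ρ of the homotopy is nonzero, x is either in K, near which χ is 1, or outside L, where χ
  -- vanishes locally. In both cases Dχ is zero.
  · intro t ht x hx
    by_contra hne
    apply hx
    by_cases hxL : x ∈ L
    · have hxK := hmem t ht x (subset_closure (hLU hxL)) hne
      have : ∀ᶠ y in 𝓝 x, χ y = 1 := (eventually_nhdsSet_iff_forall.1 hχ1) x hxK
      have h1 : (χ : E → ℝ) =ᶠ[𝓝 x] fun _ => (1 : ℝ) := this
      rw [h1.fderiv_eq]
      simp
    · have h1 : x ∉ tsupport χ := fun h => hxL (hχs h)
      have : (χ : E → ℝ) =ᶠ[𝓝 x] fun _ => (0 : ℝ) := notMem_tsupport_iff_eventuallyEq.1 h1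
      rw [this.fderiv_eq]
      simp

end Jacobian

/-! ### The degree integral as a signed count of preimages -/

section Count

variable {E : Type*} [NormedAddCommGroup E] [NormedSpace ℝ E] [FiniteDimensional ℝ E]

/-- Local inversion: near a regular point a smooth map is injective, open, and the sign of its
Jacobian determinant is constant. -/
theorem exists_isOpen_injOn_sign_eq {g : E → E} (hg : ContDiff ℝ ∞ g) {x : E}
    (hx : (fderiv ℝ g x).det ≠ 0) :
    ∃ W : Set E, IsOpen W ∧ x ∈ W ∧ InjOn g W ∧ (∀ V ⊆ W, IsOpen V → IsOpen (g '' V)) ∧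
      ∀ z ∈ W, SignType.sign (fderiv ℝ g z).det = SignType.sign (fderiv ℝ g x).det := by
  have hs : HasStrictFDerivAt g
      ((fderiv ℝ g x).toContinuousLinearEquivOfDetNeZero hx : E →L[ℝ] E) x := by
    rw [ContinuousLinearMap.coe_toContinuousLinearEquivOfDetNeZero]
    exact hg.contDiffAt.hasStrictFDerivAt (by simp)
  let e := hs.toOpenPartialHomeomorph g
  have he : (e : E → E) = g := hs.toOpenPartialHomeomorph_coe
  have hcont : ContinuousAt (fun z => (fderiv ℝ g z).det) x :=
    (continuous_det_fderiv hg).continuousAt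
  have hsign : ∀ᶠ z in 𝓝 x, SignType.sign (fderiv ℝ g z).det =
      SignType.sign (fderiv ℝ g x).det := by
    rcases lt_or_gt_of_ne hx with h | h
    · filter_upwards [hcont.eventually (gt_mem_nhds h)] with z hz
      rw [sign_neg hz, sign_neg h]
    · filter_upwards [hcont.eventually (lt_mem_nhds h)] with z hz
      rw [sign_pos hz, sign_pos h]
  obtain ⟨W, hW, hWo, hxW⟩ := eventually_nhds_iff.1 hsign
  refine ⟨W ∩ e.source, hWo.inter e.open_source,
    ⟨hxW, hs.mem_toOpenPartialHomeomorph_source⟩, ?_, ?_, fun z hz => hW z hz.1⟩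
  · rw [← he]
    exact e.injOn.mono inter_subset_right
  · intro V hV hVo
    rw [← he]
    exact e.isOpen_image_of_subset_source hVo (hV.trans inter_subset_right)

/-- The fibre is compact because it avoids the frontier, and discrete by local inversion. -/
theorem finite_regular_fiber {U : Set E} (hU : IsOpen U)
    (hUb : Bornology.IsBounded U) {g : E → E} (hg : ContDiff ℝ ∞ g) {y : E}
    (hy : ∀ x ∈ frontier U, g x ≠ y) (hreg : ∀ x ∈ U, g x = y → (fderiv ℝ g x).det ≠ 0) :
    {x | x ∈ U ∧ g x = y}.Finite := by
  have hS : {x | x ∈ U ∧ g x = y} = closure U ∩ g ⁻¹' {y} := by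
    ext x
    refine ⟨fun h => ⟨subset_closure h.1, h.2⟩, fun h => ⟨?_, h.2⟩⟩
    by_contra hxU
    exact hy x (by rw [hU.frontier_eq]; exact ⟨h.1, hxU⟩) h.2
  have hc : IsCompact {x | x ∈ U ∧ g x = y} := by
    rw [hS]
    exact hUb.isCompact_closure.inter_right (isClosed_singleton.preimage hg.continuous)
  refine hc.finite ?_
  rw [isDiscrete_iff_forall_mem_exists_isOpen]
  rintro x ⟨hxU, hxy⟩
  obtain ⟨W, hWo, hxW, hinj, -, -⟩ := exists_isOpen_injOn_sign_eq hg (hreg x hxU hxy)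
  refine ⟨W, hWo, ?_⟩
  ext z
  simp only [mem_inter_iff, mem_ofPred_eq, mem_singleton_iff]
  constructor
  · rintro ⟨hz, -, hzy⟩
    exact hinj hz hxW (hzy.trans hxy.symm)
  · rintro rfl
    exact ⟨hxW, hxU, hxy⟩

variable [MeasureSpace E] [BorelSpace E] [(volume : Measure E).IsAddHaarMeasure]

theorem integrableOn_comp_mul_jacobian {U : Set E} (hUb : Bornology.IsBounded U) {g : E → E}
    (hg : ContDiff ℝ ∞ g) {ρ : E → ℝ} (hρ : Continuous ρ) :
    IntegrableOn (fun x => ρ (g x) * (fderiv ℝ g x).det) U :=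
  (((hρ.comp hg.continuous).mul (continuous_det_fderiv hg)).continuousOn.integrableOn_compact
    hUb.isCompact_closure).mono_set subset_closure

/-- The degree integral over a regular value counts preimages with sign. -/
theorem exists_setIntegral_jacobian_eq_finsum_sign {U : Set E} (hU : IsOpen U)
    (hUb : Bornology.IsBounded U) {g : E → E} (hg : ContDiff ℝ ∞ g) {y : E}
    (hy : ∀ x ∈ frontier U, g x ≠ y) (hreg : ∀ x ∈ U, g x = y → (fderiv ℝ g x).det ≠ 0) :
    ∃ ε > 0, ∀ ρ : E → ℝ, Continuous ρ → Function.support ρ ⊆ Metric.ball y ε →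
      ∫ x in U, ρ (g x) * (fderiv ℝ g x).det =
        ((∑ᶠ x ∈ {x | x ∈ U ∧ g x = y},
          ((SignType.sign (fderiv ℝ g x).det : SignType) : ℤ) : ℤ) : ℝ) * ∫ z, ρ z := by
  classical
  have hfin := finite_regular_fiber hU hUb hg hy hreg
  set S := {x | x ∈ U ∧ g x = y} with hSdef
  obtain ⟨T, hT, hTd⟩ := hfin.t2_separation
  have hex : ∀ x : E, ∃ W : Set E, x ∈ S → (IsOpen W ∧ x ∈ W ∧ W ⊆ U ∧ W ⊆ T x ∧ InjOn g W ∧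
      IsOpen (g '' W) ∧
      ∀ z ∈ W, SignType.sign (fderiv ℝ g z).det = SignType.sign (fderiv ℝ g x).det) := by
    intro x
    by_cases hx : x ∈ S
    · obtain ⟨W, hWo, hxW, hinj, himg, hsign⟩ := exists_isOpen_injOn_sign_eq hg (hreg x hx.1 hx.2)
      have ho : IsOpen (W ∩ (U ∩ T x)) := hWo.inter (hU.inter (hT x).2)
      exact ⟨W ∩ (U ∩ T x), fun _ => ⟨ho, ⟨hxW, hx.1, (hT x).1⟩, fun z hz => hz.2.1,
        fun z hz => hz.2.2, hinj.mono inter_subset_left, himg _ inter_subset_left ho,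
        fun z hz => hsign z hz.1⟩⟩
    · exact ⟨∅, fun h => absurd h hx⟩
  choose W hW using hex
  have hWU : IsOpen (⋃ x ∈ S, W x) := isOpen_biUnion fun x hx => (hW x hx).1
  have hC : IsCompact (closure U \ ⋃ x ∈ S, W x) := hUb.isCompact_closure.diff hWU
  have hyC : y ∉ g '' (closure U \ ⋃ x ∈ S, W x) := by
    rintro ⟨x, ⟨hxU, hxW⟩, hxy⟩
    by_cases hx : x ∈ U
    · exact hxW (mem_biUnion (show x ∈ S from ⟨hx, hxy⟩) (hW x ⟨hx, hxy⟩).2.1)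
    · exact hy x (by rw [hU.frontier_eq]; exact ⟨hxU, hx⟩) hxy
  -- A small ball around y misses the image of everything outside the sheets W x and lies in the
  -- image of every sheet. Only the sheets contribute to the integral, and each one covers the
  -- support of ρ exactly once.
  have hN : (g '' (closure U \ ⋃ x ∈ S, W x))ᶜ ∩ ⋂ x ∈ S, g '' W x ∈ 𝓝 y := by
    refine inter_mem ((hC.image hg.continuous).isClosed.isOpen_compl.mem_nhds hyC) ?_
    refine (biInter_mem hfin).2 fun x hx => ?_
    exact (hW x hx).2.2.2.2.2.1.mem_nhds ⟨x, (hW x hx).2.1, hx.2⟩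
  obtain ⟨ε, hε, hball⟩ := Metric.mem_nhds_iff.1 hN
  refine ⟨ε, hε, fun ρ hρ hsupp => ?_⟩
  have hint := integrableOn_comp_mul_jacobian hUb hg hρ
  have hsub : (⋃ x ∈ S, W x) ⊆ U := iUnion₂_subset fun x hx => (hW x hx).2.2.1
  have e1 : ∫ x in U, ρ (g x) * (fderiv ℝ g x).det =
      ∫ x in ⋃ x ∈ hfin.toFinset, W x, ρ (g x) * (fderiv ℝ g x).det := by
    have : (⋃ x ∈ hfin.toFinset, W x) = ⋃ x ∈ S, W x := by simp
    rw [this]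
    refine setIntegral_eq_of_subset_of_forall_sdiff_eq_zero hU.measurableSet hsub fun x hx => ?_
    have : g x ∉ Metric.ball y ε := fun h =>
      (hball h).1 ⟨x, ⟨subset_closure hx.1, hx.2⟩, rfl⟩
    have h0 : ρ (g x) = 0 := by
      by_contra hne
      exact this (hsupp hne)
    rw [h0, zero_mul]
  rw [e1, integral_biUnion_finset]
  · rw [finsum_mem_eq_finite_toFinset_sum _ hfin, Int.cast_sum, Finset.sum_mul]
    refine Finset.sum_congr rfl fun x hx => ?_
    have hxS : x ∈ S := hfin.mem_toFinset.1 hx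
    obtain ⟨hWo, hxW, hWU', hWT, hinj, himg, hsign⟩ := hW x hxS
    have e2 : ∫ z in g '' W x, ρ z = ∫ z, ρ z := by
      refine setIntegral_eq_integral_of_forall_compl_eq_zero fun z hz => ?_
      by_contra hne
      exact hz (mem_iInter₂.1 (hball (hsupp hne)).2 x hxS)
    rw [← e2, integral_image_eq_integral_abs_det_fderiv_smul volume hWo.measurableSet
      (fun z _ => ((hg.differentiable (by simp)) z).hasFDerivAt.hasFDerivWithinAt) hinj,
      ← integral_const_mul]
    refine setIntegral_congr_fun hWo.measurableSet fun z hz => ?_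
    -- The change of variables produces |det Dg|; the sign, constant on the sheet, turns it back
    -- into det Dg.
    have h1 : ((((SignType.sign (fderiv ℝ g x).det : SignType) : ℤ)) : ℝ) =
        (SignType.sign (fderiv ℝ g z).det : SignType) := by
      rw [hsign z hz]
      cases SignType.sign (fderiv ℝ g x).det <;> simp
    simp only [smul_eq_mul]
    rw [h1, ← mul_assoc, sign_mul_abs, mul_comm]
  · exact fun x hx => (hW x (hfin.mem_toFinset.1 hx)).1.measurableSet
  · intro x hx z hz hxz
    exact (hTd (hfin.mem_toFinset.1 hx) (hfin.mem_toFinset.1 hz) hxz).mono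
      (hW x (hfin.mem_toFinset.1 hx)).2.2.2.1 (hW z (hfin.mem_toFinset.1 hz)).2.2.2.1
  · exact fun x hx => hint.mono_set (hW x (hfin.mem_toFinset.1 hx)).2.2.1

end Count

/-! ### Existence of the Brouwer degree and its integral formula -/

section Degree

variable {E : Type*} [NormedAddCommGroup E] [NormedSpace ℝ E] [FiniteDimensional ℝ E]

theorem exists_normalBump (r : ℝ) (hr : 0 < r) : ∃ φ : ContDiffBump (0 : E), φ.rOut = r :=
  ⟨⟨r / 2, r, half_pos hr, half_lt_self hr⟩, rfl⟩

/-- Tietze extension from K to the whole space, followed by smoothing of the extension. -/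
theorem exists_contDiff_dist_lt_on_isCompact {K : Set E} (hK : IsCompact K) {f : E → E}
    (hf : ContinuousOn f K) {e : ℝ} (he : 0 < e) :
    ∃ g : E → E, ContDiff ℝ ∞ g ∧ ∀ x ∈ K, dist (g x) (f x) < e := by
  obtain ⟨F, hF⟩ := ContinuousMap.exists_restrict_eq hK.isClosed
    (⟨K.domRestrict f, continuousOn_iff_continuous_domRestrict.1 hf⟩ : C(K, E))
  obtain ⟨g, hg, hgF, -⟩ := F.continuous.exists_contDiff_approx (ε := fun _ => e) ⊤
    continuous_const fun _ => he
  refine ⟨g, hg, fun x hx => ?_⟩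
  have : F x = f x := congrArg (fun k : C(K, E) => k ⟨x, hx⟩) hF
  rw [← this]
  exact hgF x

variable [MeasureSpace E] [BorelSpace E] [(volume : Measure E).IsAddHaarMeasure]

/-- By Sard's theorem the critical values form a null set, so some regular value lies within e/2 of
y. Translating the smooth approximation moves that value to y, and the other e/2 is left for the
approximation itself. -/
theorem exists_contDiff_dist_lt_regular {K : Set E} (hK : IsCompact K) {f : E → E}
    (hf : ContinuousOn f K) (y : E) {e : ℝ} (he : 0 < e) :
    ∃ g : E → E, ContDiff ℝ ∞ g ∧ (∀ x ∈ K, dist (g x) (f x) < e) ∧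
      ∀ x, g x = y → (fderiv ℝ g x).det ≠ 0 := by
  obtain ⟨g, hg, hgf⟩ := exists_contDiff_dist_lt_on_isCompact hK hf (half_pos he)
  have hnull : volume (g '' {x | (fderiv ℝ g x).det = 0}) = 0 :=
    addHaar_image_eq_zero_of_det_fderivWithin_eq_zero volume
      (fun x _ => ((hg.differentiable (by simp)) x).hasFDerivAt.hasFDerivWithinAt) fun x hx => hx
  obtain ⟨z, hzb, hz⟩ : ∃ z ∈ Metric.ball y (e / 2), z ∉ g '' {x | (fderiv ℝ g x).det = 0} := by
    by_contra! h
    have h1 : volume (Metric.ball y (e / 2)) ≤ 0 := hnull ▸ measure_mono h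
    exact (Metric.measure_ball_pos volume y (half_pos he)).not_ge h1
  refine ⟨fun x => g x - (z - y), hg.sub contDiff_const, fun x hx => ?_, fun x hx => ?_⟩
  · calc dist (g x - (z - y)) (f x) ≤ dist (g x - (z - y)) (g x) + dist (g x) (f x) :=
          dist_triangle _ _ _
      _ < e / 2 + e / 2 := by
          refine add_lt_add ?_ (hgf x hx)
          rw [dist_eq_norm, sub_sub_cancel_left, norm_neg, ← dist_eq_norm]
          exact hzb
      _ = e := add_halves e
  · rw [fderiv_sub_const]
    intro h0
    refine hz ⟨x, h0, ?_⟩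
    have := sub_eq_iff_eq_add.1 hx
    rw [this]
    abel

/-- Existence of the Brouwer degree. -/
theorem exists_hasBrouwerDegree {U : Set E}
    (hUb : Bornology.IsBounded U) {f : E → E} (hf : ContinuousOn f (closure U)) {y : E}
    {δ : ℝ} (hδ : 0 < δ) (hfy : ∀ z ∈ frontier U, δ ≤ dist y (f z)) :
    ∃ k : ℤ, HasBrouwerDegree f U y k := by
  obtain ⟨g, hg, hgf, hreg⟩ := exists_contDiff_dist_lt_regular hUb.isCompact_closure hf y hδ
  exact ⟨_, g, hg, fun x hx z hz => (hgf x hx).trans_le (hfy z hz), fun x _ => hreg x, rfl⟩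

/-- The Brouwer degree computes the degree integrals of translates of small bumps. -/
theorem HasBrouwerDegree.exists_setIntegral_bump_eq {U : Set E} (hU : IsOpen U)
    (hUb : Bornology.IsBounded U) {f : E → E} (hf : ContinuousOn f (closure U)) {y : E} {k : ℤ}
    (hk : HasBrouwerDegree f U y k) {δ r : ℝ} (hr : r < δ / 2)
    (hfy : ∀ z ∈ frontier U, δ ≤ dist y (f z)) {g : E → E} (hg : ContDiff ℝ ∞ g)
    (hgf : ∀ x ∈ closure U, dist (g x) (f x) < δ / 2) :
    ∃ ε > 0, ∀ φ : ContDiffBump (0 : E), φ.rOut < ε → ∀ w ∈ Metric.ball y r,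
      ∫ x in U, φ.normed volume (g x - w) * (fderiv ℝ g x).det = k := by
  obtain ⟨g₀, hg₀, hclose, hreg, hcount⟩ := hk
  have hfr : frontier U ⊆ closure U := frontier_subset_closure
  have hy : ∀ x ∈ frontier U, g₀ x ≠ y := by
    intro x hx h
    have := hclose x (hfr hx) x hx
    rw [h] at this
    exact lt_irrefl _ this
  obtain ⟨ε₀, hε₀, hcnt⟩ := exists_setIntegral_jacobian_eq_finsum_sign hU hUb hg₀ hy hreg
  -- The homotopy goes from the witness g₀ to the translate of g that carries w to y. On the
  -- frontier, μ bounds from below the room left by g₀, and δ / 2 - r the room left by the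
  -- translate; the bump must be narrower than both.
  obtain ⟨μ, hμ, hμf⟩ := (hUb.isCompact_closure.of_isClosed_subset isClosed_frontier
    hfr).exists_forall_le' (f := fun z => dist y (f z) - dist (g₀ z) (f z)) (a := 0)
    (by
      have h1 := hf.mono hfr
      have h2 := hg₀.continuous.continuousOn (s := frontier U)
      fun_prop)
    (fun z hz => sub_pos.2 (hclose z (hfr hz) z hz))
  refine ⟨min ε₀ (min μ (δ / 2 - r)), lt_min hε₀ (lt_min hμ (by linarith)), fun φ hφ w hw => ?_⟩
  have hφ0 : φ.rOut < ε₀ := hφ.trans_le (min_le_left _ _)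
  have hφ1 : φ.rOut < μ := hφ.trans_le ((min_le_right _ _).trans (min_le_left _ _))
  have hφ2 : φ.rOut < δ / 2 - r := hφ.trans_le ((min_le_right _ _).trans (min_le_right _ _))
  set ρ : E → ℝ := fun z => φ.normed volume (z - y) with hρdef
  have hρ : ContDiff ℝ ∞ ρ := (φ.contDiff_normed (n := ⊤)).comp (contDiff_id.sub contDiff_const)
  have hρs : Function.support ρ ⊆ Metric.ball y φ.rOut := by
    intro z hz
    have : z - y ∈ Function.support (φ.normed (volume : Measure E)) := hz
    rw [φ.support_normed_eq, mem_ball_zero_iff] at this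
    rwa [mem_ball_iff_norm]
  have hρt : tsupport ρ ⊆ Metric.closedBall y φ.rOut :=
    closure_minimal (hρs.trans Metric.ball_subset_closedBall) Metric.isClosed_closedBall
  have hρi : ∫ z, ρ z = 1 := by
    rw [hρdef, integral_sub_right_eq_self (fun z => φ.normed volume z) y, φ.integral_normed]
  set h : E → E := fun x => g x - (w - y) - g₀ x with hhdef
  have hh : ContDiff ℝ ∞ h := (hg.sub contDiff_const).sub hg₀
  have key := setIntegral_jacobian_eq_of_line hU hUb hρ hg₀ hh ?_
  · rw [hcnt ρ hρ.continuous (hρs.trans (Metric.ball_subset_ball hφ0.le)), hcount, hρi,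
      mul_one] at key
    rw [← key]
    have e1 : (fun x => g₀ x + h x) = fun x => g x - (w - y) := by
      ext x; simp [hhdef]
    have e2 : ∀ x, g₀ x + h x = g x - (w - y) := fun x => congrFun e1 x
    simp only [e2, fderiv_sub_const, hρdef]
    refine setIntegral_congr_fun hU.measurableSet fun x _ => ?_
    congr 2
    abel
  · intro t ht z hz hmem
    have h1 := hρt hmem
    rw [Metric.mem_closedBall, dist_comm] at h1
    have h2 : dist (g₀ z + t • h z) (f z) ≤
        (1 - t) * dist (g₀ z) (f z) + t * (dist (g z) (f z) + dist w y) := by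
      have : g₀ z + t • h z - f z = (1 - t) • (g₀ z - f z) + t • ((g z - f z) - (w - y)) := by
        simp only [hhdef]; module
      rw [dist_eq_norm, this]
      refine (norm_add_le _ _).trans ?_
      rw [norm_smul, norm_smul, Real.norm_of_nonneg ht.1, Real.norm_of_nonneg (sub_nonneg.2 ht.2),
        dist_eq_norm, dist_eq_norm, dist_eq_norm]
      gcongr
      · exact ht.1
      · exact norm_sub_le _ _
    have h3 := dist_triangle y (g₀ z + t • h z) (f z)
    have h4 := hμf z hz
    have h5 := hgf z (hfr hz)
    have h6 : dist w y < r := hw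
    have h7 := hfy z hz
    have ht0 := ht.1
    have ht1 := ht.2
    have h8 : (1 - t) * (dist y (f z) - dist (g₀ z) (f z) - φ.rOut) ≥ 0 :=
      mul_nonneg (sub_nonneg.2 ht1) (by linarith)
    have h9 : t * (dist y (f z) - (dist (g z) (f z) + dist w y) - φ.rOut) ≥ 0 :=
      mul_nonneg ht0 (by linarith)
    -- The room at time t is a convex combination of the two end values. The strict inequality comes
    -- from the g₀ end when t = 0 and from the other end when t > 0.
    rcases eq_or_lt_of_le ht0 with rfl | htp
    · have : (0 : ℝ) < dist y (f z) - dist (g₀ z) (f z) - φ.rOut := by linarith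
      linarith
    · have : 0 < t * (dist y (f z) - (dist (g z) (f z) + dist w y) - φ.rOut) :=
        mul_pos htp (by linarith)
      linarith

/-- The degree integral of a map close to `f` is the Brouwer degree of `f`, for every density
supported near the base point. -/
theorem HasBrouwerDegree.setIntegral_eq {U : Set E} (hU : IsOpen U)
    (hUb : Bornology.IsBounded U) {f : E → E} (hf : ContinuousOn f (closure U)) {y : E} {k : ℤ}
    (hk : HasBrouwerDegree f U y k) {δ : ℝ} (hδ : 0 < δ)
    (hfy : ∀ z ∈ frontier U, δ ≤ dist y (f z)) {g : E → E} (hg : ContDiff ℝ ∞ g)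
    (hgf : ∀ x ∈ closure U, dist (g x) (f x) < δ / 2) {ρ : E → ℝ} (hρ : Continuous ρ)
    (hρs : tsupport ρ ⊆ Metric.ball y (δ / 2)) :
    ∫ x in U, ρ (g x) * (fderiv ℝ g x).det = k * ∫ z, ρ z := by
  -- The support of ρ is compact, so it stays within a radius r strictly below δ / 2, as the
  -- statement for narrow bumps requires.
  obtain ⟨r, hr, hρr⟩ := exists_pos_lt_subset_ball (half_pos hδ) (isClosed_tsupport ρ) hρs
  obtain ⟨ε, hε, hbump⟩ := hk.exists_setIntegral_bump_eq hU hUb hf hr.2 hfy hg hgf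
  have hρc : HasCompactSupport ρ := Metric.isCompact_of_isClosed_isBounded (isClosed_tsupport ρ)
    (Metric.isBounded_ball.subset hρr)
  have hJ : IntegrableOn (fun x => (fderiv ℝ g x).det) U :=
    ((continuous_det_fderiv hg).continuousOn.integrableOn_compact
      hUb.isCompact_closure).mono_set subset_closure
  set C := ∫ x in U, |(fderiv ℝ g x).det| with hC
  have hC0 : 0 ≤ C := integral_nonneg fun x => abs_nonneg _
  -- Narrow bumps centred at any w in the support of ρ have integral k. Averaging them against ρ
  -- gives the convolution c, for which the formula holds exactly, and c is uniformly within η of ρ.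
  have hle : ∀ η > 0, |(∫ x in U, ρ (g x) * (fderiv ℝ g x).det) - k * ∫ z, ρ z| ≤ η * C := by
    intro η hη
    obtain ⟨ε', hε', huc⟩ := Metric.uniformContinuous_iff.1
      (hρ.uniformContinuous_of_tendsto_cocompact hρc.is_zero_at_infty) η hη
    obtain ⟨φ, hφ⟩ := exists_normalBump (E := E) (min ε ε' / 2) (by positivity)
    have hφε : φ.rOut < ε := by
      rw [hφ]; exact (half_lt_self (by positivity)).trans_le (min_le_left _ _)
    have hφε' : φ.rOut < ε' := by
      rw [hφ]; exact (half_lt_self (by positivity)).trans_le (min_le_right _ _)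
    have hφc : Continuous (φ.normed (volume : Measure E)) := φ.continuous_normed
    set c : E → ℝ := fun z => ∫ w, φ.normed volume (z - w) * ρ w with hcdef
    have hc : ∀ z, |ρ z - c z| ≤ η := by
      intro z
      have := φ.dist_normed_convolution_le (μ := volume) (g := ρ) (x₀ := z) (ε := η)
        hρ.aestronglyMeasurable fun x hx => (huc (lt_trans hx hφε')).le
      rw [convolution_lsmul_swap, dist_comm] at this
      exact this
    have hFint : Integrable (Function.uncurry fun (x w : E) =>
        φ.normed volume (g x - w) * ρ w * (fderiv ℝ g x).det)
        ((volume.restrict U).prod volume) := by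
      have hcont : Continuous (Function.uncurry fun (x w : E) =>
          φ.normed volume (g x - w) * ρ w * (fderiv ℝ g x).det) := by
        have h1 := hg.continuous
        have h2 := continuous_det_fderiv hg
        exact ((hφc.comp ((h1.comp continuous_fst).sub continuous_snd)).mul
          (hρ.comp continuous_snd)).mul (h2.comp continuous_fst)
      have h1 : IntegrableOn (Function.uncurry fun (x w : E) =>
          φ.normed volume (g x - w) * ρ w * (fderiv ℝ g x).det) (U ×ˢ tsupport ρ)
          (volume.prod volume) :=
        (hcont.continuousOn.integrableOn_compact
          (hUb.isCompact_closure.prod hρc)).mono_set (prod_mono subset_closure subset_rfl)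
      have h2 : IntegrableOn (Function.uncurry fun (x w : E) =>
          φ.normed volume (g x - w) * ρ w * (fderiv ℝ g x).det) (U ×ˢ univ)
          (volume.prod volume) := by
        refine h1.of_forall_sdiff_eq_zero (hU.measurableSet.prod MeasurableSet.univ) ?_
        rintro ⟨x, w⟩ ⟨⟨hx, -⟩, hn⟩
        have : w ∉ tsupport ρ := fun h => hn ⟨hx, h⟩
        simp [Function.uncurry, image_eq_zero_of_notMem_tsupport this]
      rwa [IntegrableOn, ← Measure.prod_restrict, Measure.restrict_univ] at h2
    -- Fubini: for each fixed w with ρ w nonzero, the inner integral is the degree integral of the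
    -- bump centred at w, which is k.
    have hsw : ∫ x in U, c (g x) * (fderiv ℝ g x).det = k * ∫ z, ρ z := by
      have h1 : ∫ x in U, c (g x) * (fderiv ℝ g x).det =
          ∫ x in U, ∫ w, φ.normed volume (g x - w) * ρ w * (fderiv ℝ g x).det := by
        congr 1
        ext x
        rw [integral_mul_const]
      rw [h1, integral_integral_swap hFint, ← integral_const_mul]
      congr 1
      ext w
      by_cases hw : ρ w = 0
      · simp [hw]
      · rw [← hbump φ hφε w (hρr (subset_tsupport _ hw)), ← integral_mul_const]
        congr 1
        ext x
        ring
    have hci : IntegrableOn (fun x => c (g x) * (fderiv ℝ g x).det) U := by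
      have := hFint.integral_prod_left
      refine this.congr (Eventually.of_forall fun x => ?_)
      simp only [Function.uncurry]
      rw [integral_mul_const]
    rw [← hsw, ← integral_sub (integrableOn_comp_mul_jacobian hUb hg hρ) hci, hC,
      ← integral_const_mul]
    refine (abs_integral_le_integral_abs).trans ?_
    refine integral_mono_of_nonneg (Eventually.of_forall fun x => abs_nonneg _)
      (hJ.abs.const_mul η) (Eventually.of_forall fun x => ?_)
    simp only
    rw [← sub_mul, abs_mul]
    exact mul_le_mul_of_nonneg_right (hc _) (abs_nonneg _)
  have h0 : |(∫ x in U, ρ (g x) * (fderiv ℝ g x).det) - k * ∫ z, ρ z| ≤ 0 := by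
    refine le_of_forall_pos_le_add fun η hη => ?_
    -- C may be zero, hence the denominator C + 1.
    refine (hle (η / (C + 1)) (by positivity)).trans ?_
    rw [zero_add, div_mul_eq_mul_div, div_le_iff₀ (by positivity)]
    nlinarith
  exact sub_eq_zero.1 (abs_nonpos_iff.1 h0)

end Degree

/-! ### Excision, local constancy and multiplicativity of the degree -/

section DegreeProperties

variable {E : Type*} [NormedAddCommGroup E] [NormedSpace ℝ E] [FiniteDimensional ℝ E]

theorem IsCompact.exists_pos_le_dist {K : Set E} (hK : IsCompact K) {f : E → E}
    (hf : ContinuousOn f K) {y : E} (hy : ∀ x ∈ K, f x ≠ y) :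
    ∃ δ > 0, ∀ x ∈ K, δ ≤ dist y (f x) :=
  hK.exists_forall_le' (by fun_prop) fun x hx => dist_pos.2 (hy x hx).symm

variable [MeasureSpace E] [BorelSpace E] [(volume : Measure E).IsAddHaarMeasure]

theorem exists_bumpDensity (y : E) {r : ℝ} (hr : 0 < r) :
    ∃ ρ : E → ℝ, Continuous ρ ∧ tsupport ρ ⊆ Metric.ball y r ∧ ∫ z, ρ z = 1 := by
  let φ : ContDiffBump y := ⟨r / 4, r / 2, by positivity, by linarith⟩
  refine ⟨φ.normed volume, φ.continuous_normed, ?_, φ.integral_normed⟩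
  rw [φ.tsupport_normed_eq]
  exact Metric.closedBall_subset_ball (half_lt_self hr)

/-- Excision and local constancy of the Brouwer degree. -/
theorem HasBrouwerDegree.eq_of_subset {U U' : Set E} (hU : IsOpen U) (hU' : IsOpen U')
    (hUb : Bornology.IsBounded U) (hUU' : U' ⊆ U) {f : E → E} (hf : ContinuousOn f (closure U))
    {y y' : E} {k k' : ℤ} (hk : HasBrouwerDegree f U y k) (hk' : HasBrouwerDegree f U' y' k')
    {δ : ℝ} (hδ : 0 < δ) (hfy : ∀ z ∈ frontier U, δ ≤ dist y (f z)) (hyy' : dist y y' < δ / 2)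
    (hy' : ∀ x ∈ closure U \ U', f x ≠ y') : k = k' := by
  have hcl : closure U' ⊆ closure U := closure_mono hUU'
  obtain ⟨δ', hδ', hfy'⟩ := (hUb.isCompact_closure.diff hU').exists_pos_le_dist
    (hf.mono sdiff_subset) hy'
  have hfr' : ∀ z ∈ frontier U', δ' ≤ dist y' (f z) := by
    intro z hz
    rw [hU'.frontier_eq] at hz
    exact hfy' z ⟨hcl hz.1, hz.2⟩
  -- One smooth map approximates f well enough for both domains. With one density near y', the two
  -- degrees become integrals of the same function over U and U', and this function vanishes on the
  -- difference.
  obtain ⟨g, hg, hgf⟩ := exists_contDiff_dist_lt_on_isCompact hUb.isCompact_closure hf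
    (half_pos (lt_min hδ hδ'))
  have hg1 : ∀ x ∈ closure U, dist (g x) (f x) < δ / 2 := fun x hx =>
    (hgf x hx).trans_le (by gcongr; exact min_le_left _ _)
  have hg2 : ∀ x ∈ closure U, dist (g x) (f x) < δ' / 2 := fun x hx =>
    (hgf x hx).trans_le (by gcongr; exact min_le_right _ _)
  -- The radius keeps the support within δ' / 2 of y' and also within δ / 2 of y, so the integral
  -- formula applies at both base points.
  obtain ⟨ρ, hρ, hρs, hρi⟩ := exists_bumpDensity y' (r := min (δ' / 2) (δ / 2 - dist y y'))
    (lt_min (half_pos hδ') (by linarith))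
  have hs1 : tsupport ρ ⊆ Metric.ball y (δ / 2) := by
    refine hρs.trans (Metric.ball_subset_ball' ?_)
    have := min_le_right (δ' / 2) (δ / 2 - dist y y')
    rw [dist_comm y' y]
    linarith
  have hs2 : tsupport ρ ⊆ Metric.ball y' (δ' / 2) :=
    hρs.trans (Metric.ball_subset_ball (min_le_left _ _))
  have i1 := hk.setIntegral_eq hU hUb hf hδ hfy hg hg1 hρ hs1
  have i2 := hk'.setIntegral_eq hU' (hUb.subset hUU') (hf.mono hcl) hδ' hfr' hg
    (fun x hx => hg2 x (hcl hx)) hρ hs2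
  have i3 : ∫ x in U, ρ (g x) * (fderiv ℝ g x).det = ∫ x in U', ρ (g x) * (fderiv ℝ g x).det := by
    refine setIntegral_eq_of_subset_of_forall_sdiff_eq_zero hU.measurableSet hUU' fun x hx => ?_
    have hx' : x ∈ closure U := subset_closure hx.1
    have : ρ (g x) = 0 := by
      by_contra hne
      have h1 : dist (g x) y' < δ' / 2 := hs2 (subset_tsupport _ hne)
      have h2 := hfy' x ⟨hx', hx.2⟩
      have h3 := hg2 x hx'
      have h4 := dist_triangle_left y' (f x) (g x)
      linarith
    rw [this, zero_mul]
  rw [i1, i2, hρi, mul_one, mul_one] at i3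
  exact_mod_cast i3

/-- Multiplicativity of the Brouwer degree, in the situation of local homeomorphisms. -/
theorem HasBrouwerDegree.comp_eq {U V V' : Set E} (hU : IsOpen U) (hV : IsOpen V)
    (hV' : IsOpen V') (hUb : Bornology.IsBounded U) (hVb : Bornology.IsBounded V)
    (hVV' : closure V' ⊆ V) {f₁ f₂ : E → E} (hf₁ : ContinuousOn f₁ (closure U))
    (hf₂ : ContinuousOn f₂ (closure V)) (hm : MapsTo f₁ (closure U) V)
    {y z : E} {k₁ k₂ k : ℤ} (hk₁ : HasBrouwerDegree f₁ U y k₁) (hk₂ : HasBrouwerDegree f₂ V' z k₂)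
    (hk : HasBrouwerDegree (f₂ ∘ f₁) U z k)
    {δ : ℝ} (hδ : 0 < δ) (hfy : ∀ x ∈ frontier U, δ ≤ dist y (f₁ x))
    (hV'y : closure V' ⊆ Metric.ball y (δ / 2)) (hz : ∀ x ∈ closure V \ V', f₂ x ≠ z) :
    k = k₂ * k₁ := by
  have hV'V : V' ⊆ V := subset_closure.trans hVV'
  obtain ⟨δ₂, hδ₂, hfz⟩ := (hVb.isCompact_closure.diff hV').exists_pos_le_dist
    (hf₂.mono sdiff_subset) hz
  have hfrV' : ∀ x ∈ frontier V', δ₂ ≤ dist z (f₂ x) := by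
    intro x hx
    rw [hV'.frontier_eq] at hx
    exact hfz x ⟨subset_closure (hVV' hx.1), hx.2⟩
  have hfrU : ∀ x ∈ frontier U, δ₂ ≤ dist z ((f₂ ∘ f₁) x) := by
    intro x hx
    refine hfz _ ⟨subset_closure (hm (frontier_subset_closure hx)), fun h => ?_⟩
    have h1 : dist (f₁ x) y < δ / 2 := hV'y (subset_closure h)
    have h2 := hfy x hx
    rw [dist_comm] at h2
    linarith
  -- The composite is allowed an error of δ₂ / 2: one quarter of δ₂ for replacing f₂ by g₂, and one
  -- for the effect on f₂ of replacing f₁ by g₁, controlled by uniform continuity.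
  obtain ⟨g₂, hg₂, hgf₂⟩ := exists_contDiff_dist_lt_on_isCompact hVb.isCompact_closure hf₂
    (show 0 < δ₂ / 4 by positivity)
  obtain ⟨e, he, huc⟩ := Metric.uniformContinuousOn_iff.1
    (hVb.isCompact_closure.uniformContinuousOn_of_continuous hf₂) (δ₂ / 4) (by positivity)
  obtain ⟨e', he', hth⟩ := (hUb.isCompact_closure.image_of_continuousOn
    hf₁).exists_thickening_subset_open hV (by rintro _ ⟨x, hx, rfl⟩; exact hm hx)
  obtain ⟨g₁, hg₁, hgf₁⟩ := exists_contDiff_dist_lt_on_isCompact hUb.isCompact_closure hf₁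
    (show 0 < min (δ / 2) (min e e') by positivity)
  have hg₁V : ∀ x ∈ closure U, g₁ x ∈ V := fun x hx => hth <| Metric.mem_thickening_iff.2
    ⟨f₁ x, ⟨x, hx, rfl⟩, (hgf₁ x hx).trans_le ((min_le_right _ _).trans (min_le_right _ _))⟩
  have hcomp : ∀ x ∈ closure U, dist ((g₂ ∘ g₁) x) ((f₂ ∘ f₁) x) < δ₂ / 2 := by
    intro x hx
    have h1 := hgf₂ (g₁ x) (subset_closure (hg₁V x hx))
    have h2 := huc (g₁ x) (subset_closure (hg₁V x hx)) (f₁ x) (subset_closure (hm hx))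
      ((hgf₁ x hx).trans_le ((min_le_right _ _).trans (min_le_left _ _)))
    have h3 := dist_triangle (g₂ (g₁ x)) (f₂ (g₁ x)) (f₂ (f₁ x))
    simp only [Function.comp]
    linarith
  obtain ⟨ρ, hρ, hρs, hρi⟩ := exists_bumpDensity z (r := δ₂ / 2) (by positivity)
  have hρ0 : ∀ w ∈ closure V \ V', ρ (g₂ w) = 0 := by
    intro w hw
    by_contra hne
    have h1 : dist (g₂ w) z < δ₂ / 2 := hρs (subset_tsupport _ hne)
    have h2 := hfz w hw
    have h3 := hgf₂ w hw.1
    have h4 := dist_triangle_left z (f₂ w) (g₂ w)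
    linarith
  -- The pullback of the density ρ by g₂, cut off to V', serves as the density for the first map.
  -- The chain rule identifies its degree integral under g₁ with that of ρ under the composite. It
  -- is continuous because ρ ∘ g₂ already vanishes on the frontier of V'.
  set ρ' : E → ℝ := V'.indicator fun w => ρ (g₂ w) * (fderiv ℝ g₂ w).det with hρ'
  have hρ'c : Continuous ρ' := by
    refine continuous_indicator (fun w hw => ?_)
      ((hρ.comp hg₂.continuous).mul (continuous_det_fderiv hg₂)).continuousOn
    rw [hV'.frontier_eq] at hw
    rw [hρ0 w ⟨subset_closure (hVV' hw.1), hw.2⟩, zero_mul]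
  have hρ's : tsupport ρ' ⊆ Metric.ball y (δ / 2) :=
    (closure_mono support_indicator_subset).trans hV'y
  have i1 := hk₁.setIntegral_eq hU hUb hf₁ hδ hfy hg₁
    (fun x hx => (hgf₁ x hx).trans_le (min_le_left _ _)) hρ'c hρ's
  have i2 := hk₂.setIntegral_eq hV' (hVb.subset hV'V) (hf₂.mono (closure_mono hV'V)) hδ₂ hfrV'
    hg₂ (fun x hx => (hgf₂ x (closure_mono hV'V hx)).trans (by linarith)) hρ hρs
  have i3 := hk.setIntegral_eq hU hUb
    (hf₂.comp hf₁ fun x hx => subset_closure (hm hx)) hδ₂ hfrU (hg₂.comp hg₁) hcomp hρ hρs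
  have i4 : ∫ x in U, ρ ((g₂ ∘ g₁) x) * (fderiv ℝ (g₂ ∘ g₁) x).det =
      ∫ x in U, ρ' (g₁ x) * (fderiv ℝ g₁ x).det := by
    refine setIntegral_congr_fun hU.measurableSet fun x hx => ?_
    have hx' := subset_closure hx
    have hdet : (fderiv ℝ (g₂ ∘ g₁) x).det =
        (fderiv ℝ g₂ (g₁ x)).det * (fderiv ℝ g₁ x).det := by
      rw [fderiv_comp x (hg₂.differentiable (by simp) _) (hg₁.differentiable (by simp) _)]
      exact LinearMap.det_comp _ _
    rw [hdet, ← mul_assoc]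
    congr 1
    by_cases hgx : g₁ x ∈ V'
    · rw [hρ', indicator_of_mem hgx]; rfl
    · rw [hρ', indicator_of_notMem hgx]
      simp only [Function.comp]
      rw [hρ0 _ ⟨subset_closure (hg₁V x hx'), hgx⟩, zero_mul]
  rw [i1, i3, hρi, hρ', integral_indicator hV'.measurableSet, i2, hρi] at i4
  have : (k : ℝ) = k₂ * k₁ := by linarith
  exact_mod_cast this

end DegreeProperties

/-! ### Germs of local homeomorphisms -/

section Germs

variable {X Y Z : Type*} [TopologicalSpace X] [TopologicalSpace Y] [TopologicalSpace Z]

/-- Near `p`, the map `f` agrees with a homeomorphism between open sets. -/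
def IsLocalHomeoGerm (f : X → Y) (p : X) : Prop :=
  ∃ e : OpenPartialHomeomorph X Y, p ∈ e.source ∧ f =ᶠ[𝓝 p] e

theorem OpenPartialHomeomorph.isLocalHomeoGerm (e : OpenPartialHomeomorph X Y) {p : X}
    (hp : p ∈ e.source) : IsLocalHomeoGerm e p :=
  ⟨e, hp, EventuallyEq.rfl⟩

theorem IsLocalHomeoGerm.congr {f g : X → Y} {p : X} (hf : IsLocalHomeoGerm f p)
    (h : g =ᶠ[𝓝 p] f) : IsLocalHomeoGerm g p :=
  let ⟨e, hp, he⟩ := hf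
  ⟨e, hp, h.trans he⟩

theorem IsLocalHomeoGerm.continuousAt {f : X → Y} {p : X} (hf : IsLocalHomeoGerm f p) :
    ContinuousAt f p :=
  let ⟨e, hp, he⟩ := hf
  (e.continuousAt hp).congr he.symm

theorem IsLocalHomeoGerm.comp {g : Y → Z} {f : X → Y} {p : X} (hg : IsLocalHomeoGerm g (f p))
    (hf : IsLocalHomeoGerm f p) : IsLocalHomeoGerm (g ∘ f) p := by
  have hc := hf.continuousAt
  obtain ⟨e, hp, he⟩ := hf
  obtain ⟨e', hp', he'⟩ := hg
  refine ⟨e.trans e', ?_, ?_⟩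
  · rw [OpenPartialHomeomorph.trans_source]
    exact ⟨hp, by rw [mem_preimage, ← he.eq_of_nhds]; exact hp'⟩
  · filter_upwards [he, hc.eventually he'] with x hx hx'
    simp only [Function.comp, OpenPartialHomeomorph.coe_trans]
    rw [hx', hx]

theorem Homeomorph.isLocalHomeoGerm (e : X ≃ₜ Y) (p : X) : IsLocalHomeoGerm e p :=
  e.toOpenPartialHomeomorph.isLocalHomeoGerm (mem_univ p)

theorem isLocalHomeoGerm_id (p : X) : IsLocalHomeoGerm id p :=
  (Homeomorph.refl X).isLocalHomeoGerm p

theorem IsLocalHomeoGerm.tendsto_nhdsNE {f : X → Y} {p : X} (hf : IsLocalHomeoGerm f p) :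
    Tendsto f (𝓝[≠] p) (𝓝[≠] (f p)) := by
  have hc := hf.continuousAt
  obtain ⟨e, hp, he⟩ := hf
  refine tendsto_nhdsWithin_iff.2 ⟨hc.tendsto.mono_left nhdsWithin_le_nhds, ?_⟩
  rw [eventually_nhdsWithin_iff]
  filter_upwards [he, e.open_source.mem_nhds hp] with q hq hqs hqp
  simp only [mem_compl_iff, mem_singleton_iff]
  rw [hq, he.eq_of_nhds]
  exact fun h => hqp (e.injOn hqs hp h)

end Germs

/-! ### The local degree of a homeomorphism germ -/

section LocalDegree

variable {E : Type*} [NormedAddCommGroup E] [NormedSpace ℝ E]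

theorem HasBrouwerDegree.congr {U : Set E} {f f' : E → E} {y : E} {k : ℤ}
    (hk : HasBrouwerDegree f U y k) (h : EqOn f f' (closure U)) : HasBrouwerDegree f' U y k := by
  obtain ⟨g, hg, hclose, h'⟩ := hk
  refine ⟨g, hg, fun x hx z hz => ?_, h'⟩
  rw [← h hx, ← h (frontier_subset_closure hz)]
  exact hclose x hx z hz

/-- `f` is injective and continuous on a small closed ball around `p`, and its Brouwer degree on
that ball over `f p` is `k`. -/
def HasLocalDegree (f : E → E) (p : E) (k : ℤ) : Prop :=
  ∃ r > 0, ContinuousOn f (Metric.closedBall p r) ∧ InjOn f (Metric.closedBall p r) ∧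
    HasBrouwerDegree f (Metric.ball p r) (f p) k

theorem OpenPartialHomeomorph.PreservesOrientationAt.hasLocalDegree
    {e : OpenPartialHomeomorph E E} {p : E} (h : e.PreservesOrientationAt p) :
    HasLocalDegree e p 1 :=
  let ⟨r, hr, hs, hk⟩ := h
  ⟨r, hr, e.continuousOn.mono hs, e.injOn.mono hs, hk⟩

theorem IsLocalHomeoGerm.exists_closedBall {f : E → E} {p : E} (hf : IsLocalHomeoGerm f p) :
    ∃ r > 0, ContinuousOn f (Metric.closedBall p r) ∧ InjOn f (Metric.closedBall p r) := by
  obtain ⟨e, hp, he⟩ := hf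
  obtain ⟨r, hr, hball⟩ := Metric.nhds_basis_closedBall.mem_iff.1
    (inter_mem (e.open_source.mem_nhds hp) he)
  have heq : EqOn f e (Metric.closedBall p r) := fun x hx => (hball hx).2
  have hsub : Metric.closedBall p r ⊆ e.source := fun x hx => (hball hx).1
  exact ⟨r, hr, (e.continuousOn.mono hsub).congr heq, (e.injOn.mono hsub).congr heq.symm⟩

variable [FiniteDimensional ℝ E]

theorem exists_pos_le_dist_frontier_ball {f : E → E} {p q : E} {r : ℝ} (hq : q ∈ Metric.ball p r)
    (hc : ContinuousOn f (Metric.closedBall p r)) (hi : InjOn f (Metric.closedBall p r)) :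
    ∃ δ > 0, ∀ z ∈ frontier (Metric.ball p r), δ ≤ dist (f q) (f z) := by
  have hr : r ≠ 0 := (Metric.pos_of_mem_ball hq).ne'
  rw [frontier_ball p hr]
  refine (isCompact_sphere p r).exists_pos_le_dist (hc.mono Metric.sphere_subset_closedBall) ?_
  intro x hx hxq
  have := hi (Metric.sphere_subset_closedBall hx) (Metric.ball_subset_closedBall hq) hxq
  subst this
  rw [Metric.mem_sphere] at hx
  rw [Metric.mem_ball, hx] at hq
  exact lt_irrefl _ hq

variable [MeasureSpace E] [BorelSpace E] [(volume : Measure E).IsAddHaarMeasure]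

theorem exists_hasBrouwerDegree_ball {f : E → E} {p : E} {r : ℝ} (hr : 0 < r)
    (hc : ContinuousOn f (Metric.closedBall p r)) (hi : InjOn f (Metric.closedBall p r)) :
    ∃ k, HasBrouwerDegree f (Metric.ball p r) (f p) k := by
  obtain ⟨δ, hδ, hfy⟩ := exists_pos_le_dist_frontier_ball (Metric.mem_ball_self hr) hc hi
  exact exists_hasBrouwerDegree Metric.isBounded_ball (by rwa [closure_ball p hr.ne']) hδ hfy

/-- By injectivity, `q` is the only point of the large closed ball sent to `f q`, so excision
applies to the small ball. -/
theorem HasBrouwerDegree.eq_of_ball_subset {f : E → E} {p q : E} {r s : ℝ}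
    (hr : 0 < r) (hs : 0 < s) (hsub : Metric.ball q s ⊆ Metric.ball p r)
    (hc : ContinuousOn f (Metric.closedBall p r)) (hi : InjOn f (Metric.closedBall p r))
    {δ : ℝ} (hδ : 0 < δ) (hfy : ∀ z ∈ frontier (Metric.ball p r), δ ≤ dist (f p) (f z))
    (hpq : dist (f p) (f q) < δ / 2) {k k' : ℤ} (hk : HasBrouwerDegree f (Metric.ball p r) (f p) k)
    (hk' : HasBrouwerDegree f (Metric.ball q s) (f q) k') : k = k' := by
  refine hk.eq_of_subset Metric.isOpen_ball Metric.isOpen_ball Metric.isBounded_ball hsub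
    (by rwa [closure_ball p hr.ne']) hk' hδ hfy hpq ?_
  rintro x ⟨hx, hxs⟩ hxq
  rw [closure_ball p hr.ne'] at hx
  have := hi hx (Metric.ball_subset_closedBall (hsub (Metric.mem_ball_self hs))) hxq
  subst this
  exact hxs (Metric.mem_ball_self hs)

theorem HasBrouwerDegree.ball_shrink {f : E → E} {p : E} {r s : ℝ} (hs : 0 < s) (hsr : s ≤ r)
    (hc : ContinuousOn f (Metric.closedBall p r)) (hi : InjOn f (Metric.closedBall p r))
    {k : ℤ} (hk : HasBrouwerDegree f (Metric.ball p r) (f p) k) :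
    HasBrouwerDegree f (Metric.ball p s) (f p) k := by
  have hr := hs.trans_le hsr
  have hsub := Metric.closedBall_subset_closedBall (x := p) hsr
  obtain ⟨k', hk'⟩ := exists_hasBrouwerDegree_ball hs (hc.mono hsub) (hi.mono hsub)
  obtain ⟨δ, hδ, hfy⟩ := exists_pos_le_dist_frontier_ball (Metric.mem_ball_self hr) hc hi
  rwa [hk.eq_of_ball_subset hr hs (Metric.ball_subset_ball hsr) hc hi hδ hfy
    (by rw [dist_self]; positivity) hk']

/-- Both degrees can be computed on the smaller of the two balls, where excision with U' = U
compares the two witnesses. -/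
theorem HasLocalDegree.unique {f : E → E} {p : E} {k k' : ℤ} (hk : HasLocalDegree f p k)
    (hk' : HasLocalDegree f p k') : k = k' := by
  obtain ⟨r, hr, hc, hi, hd⟩ := hk
  obtain ⟨r', hr', hc', hi', hd'⟩ := hk'
  have h1 := hd.ball_shrink (lt_min hr hr') (min_le_left _ _) hc hi
  have h2 := hd'.ball_shrink (lt_min hr hr') (min_le_right _ _) hc' hi'
  have hsub := Metric.closedBall_subset_closedBall (x := p) (min_le_left r r')
  obtain ⟨δ, hδ, hfy⟩ := exists_pos_le_dist_frontier_ball (Metric.mem_ball_self (lt_min hr hr'))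
    (hc.mono hsub) (hi.mono hsub)
  exact h1.eq_of_ball_subset (lt_min hr hr') (lt_min hr hr') subset_rfl (hc.mono hsub)
    (hi.mono hsub) hδ hfy (by rw [dist_self]; positivity) h2

theorem HasLocalDegree.exists_ball {f : E → E} {p : E} {k : ℤ} (hk : HasLocalDegree f p k)
    {s : Set E} (hs : s ∈ 𝓝 p) : ∃ r > 0, Metric.closedBall p r ⊆ s ∧
      ContinuousOn f (Metric.closedBall p r) ∧ InjOn f (Metric.closedBall p r) ∧
      HasBrouwerDegree f (Metric.ball p r) (f p) k := by
  obtain ⟨r, hr, hc, hi, hd⟩ := hk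
  obtain ⟨r', hr', hball⟩ := Metric.nhds_basis_closedBall.mem_iff.1 hs
  have hsub := Metric.closedBall_subset_closedBall (x := p) (min_le_left r r')
  exact ⟨min r r', lt_min hr hr',
    (Metric.closedBall_subset_closedBall (min_le_right _ _)).trans hball, hc.mono hsub,
    hi.mono hsub, hd.ball_shrink (lt_min hr hr') (min_le_left _ _) hc hi⟩

theorem HasLocalDegree.congr {f f' : E → E} {p : E} {k : ℤ} (hk : HasLocalDegree f p k)
    (h : f' =ᶠ[𝓝 p] f) : HasLocalDegree f' p k := by
  obtain ⟨r, hr, hs, hc, hi, hd⟩ := hk.exists_ball h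
  refine ⟨r, hr, hc.congr hs, hi.congr (EqOn.symm hs), ?_⟩
  rw [h.eq_of_nhds]
  refine hd.congr ?_
  rw [closure_ball p hr.ne']
  exact EqOn.symm hs

theorem OpenPartialHomeomorph.preservesOrientationAt_iff {e : OpenPartialHomeomorph E E} {p : E}
    (hp : p ∈ e.source) : e.PreservesOrientationAt p ↔ HasLocalDegree e p 1 := by
  refine ⟨fun h => h.hasLocalDegree, fun h => ?_⟩
  obtain ⟨r, hr, hs, -, -, hd⟩ := h.exists_ball (e.open_source.mem_nhds hp)
  exact ⟨r, hr, hs, hd⟩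

theorem IsLocalHomeoGerm.exists_hasLocalDegree {f : E → E} {p : E} (hf : IsLocalHomeoGerm f p) :
    ∃ k, HasLocalDegree f p k := by
  obtain ⟨r, hr, hc, hi⟩ := hf.exists_closedBall
  obtain ⟨k, hk⟩ := exists_hasBrouwerDegree_ball hr hc hi
  exact ⟨k, r, hr, hc, hi, hk⟩

theorem HasLocalDegree.eventually {f : E → E} {p : E} {k : ℤ} (hk : HasLocalDegree f p k) :
    ∀ᶠ q in 𝓝 p, HasLocalDegree f q k := by
  obtain ⟨r, hr, hc, hi, hd⟩ := hk
  obtain ⟨δ, hδ, hfy⟩ := exists_pos_le_dist_frontier_ball (Metric.mem_ball_self hr) hc hi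
  have hcp : ContinuousAt f p := hc.continuousAt (Metric.closedBall_mem_nhds p hr)
  filter_upwards [Metric.ball_mem_nhds p hr, hcp (Metric.ball_mem_nhds _ (half_pos hδ))]
    with q hq hq'
  rw [mem_preimage, Metric.mem_ball, dist_comm] at hq'
  obtain ⟨s, hs, hball⟩ := Metric.nhds_basis_closedBall.mem_iff.1
    (Metric.isOpen_ball.mem_nhds hq)
  have hsub := hball.trans Metric.ball_subset_closedBall
  obtain ⟨k', hk'⟩ := exists_hasBrouwerDegree_ball hs (hc.mono hsub) (hi.mono hsub)
  have := hd.eq_of_ball_subset hr hs (Metric.ball_subset_closedBall.trans hball) hc hi hδ hfy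
    hq' hk'
  exact ⟨s, hs, hc.mono hsub, hi.mono hsub, this ▸ hk'⟩

/-- The target ball for `f₂` is shrunk until it fits in the neighbourhood of `f₁ p` on which the
degree integral of `f₁` is under control; injectivity of `f₂` ensures that nothing outside it
reaches the base value. -/
theorem HasLocalDegree.comp {f₁ f₂ : E → E} {p : E} {k₁ k₂ : ℤ}
    (h₁ : HasLocalDegree f₁ p k₁) (h₂ : HasLocalDegree f₂ (f₁ p) k₂) :
    HasLocalDegree (f₂ ∘ f₁) p (k₂ * k₁) := by
  obtain ⟨s, hs, hc₂, hi₂, hd₂⟩ := h₂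
  have hcp : ContinuousAt f₁ p := by
    obtain ⟨r, hr, hc, -⟩ := h₁
    exact hc.continuousAt (Metric.closedBall_mem_nhds p hr)
  obtain ⟨r, hr, hm, hc₁, hi₁, hd₁⟩ := h₁.exists_ball (hcp (Metric.ball_mem_nhds (f₁ p) hs))
  have hm' : MapsTo f₁ (Metric.closedBall p r) (Metric.closedBall (f₁ p) s) :=
    fun x hx => Metric.ball_subset_closedBall (hm hx)
  have hc : ContinuousOn (f₂ ∘ f₁) (Metric.closedBall p r) := hc₂.comp hc₁ hm'
  have hi : InjOn (f₂ ∘ f₁) (Metric.closedBall p r) := hi₂.comp hi₁ hm'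
  obtain ⟨k, hk⟩ := exists_hasBrouwerDegree_ball hr hc hi
  obtain ⟨δ, hδ, hfy⟩ := exists_pos_le_dist_frontier_ball (Metric.mem_ball_self hr) hc₁ hi₁
  have ht : 0 < min (s / 2) (δ / 4) := by positivity
  have hts : min (s / 2) (δ / 4) < s := (min_le_left _ _).trans_lt (half_lt_self hs)
  have htδ : min (s / 2) (δ / 4) < δ / 2 := (min_le_right _ _).trans_lt (by linarith)
  have := HasBrouwerDegree.comp_eq (V := Metric.ball (f₁ p) s)
    (V' := Metric.ball (f₁ p) (min (s / 2) (δ / 4))) Metric.isOpen_ball Metric.isOpen_ball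
    Metric.isOpen_ball Metric.isBounded_ball Metric.isBounded_ball
    (Metric.closure_ball_subset_closedBall.trans (Metric.closedBall_subset_ball hts))
    (by rwa [closure_ball p hr.ne']) (by rwa [closure_ball _ hs.ne'])
    (by rw [closure_ball p hr.ne']; exact hm) hd₁ (hd₂.ball_shrink ht hts.le hc₂ hi₂) hk hδ hfy
    (Metric.closure_ball_subset_closedBall.trans (Metric.closedBall_subset_ball htδ)) ?_
  · exact this ▸ ⟨r, hr, hc, hi, hk⟩
  · rintro x ⟨hx, hxs⟩ hxq
    rw [closure_ball _ hs.ne'] at hx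
    have := hi₂ hx (Metric.mem_closedBall_self hs.le) hxq
    subst this
    exact hxs (Metric.mem_ball_self ht)

open Classical in
/-- The local degree of `f` at `p`. -/
noncomputable def localDegree (f : E → E) (p : E) : ℤ :=
  if h : ∃ k, HasLocalDegree f p k then h.choose else 0

theorem HasLocalDegree.localDegree_eq {f : E → E} {p : E} {k : ℤ} (hk : HasLocalDegree f p k) :
    localDegree f p = k := by
  have h : ∃ k, HasLocalDegree f p k := ⟨k, hk⟩
  rw [localDegree, dif_pos h]
  exact h.choose_spec.unique hk

theorem IsLocalHomeoGerm.hasLocalDegree {f : E → E} {p : E} (hf : IsLocalHomeoGerm f p) :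
    HasLocalDegree f p (localDegree f p) := by
  obtain ⟨k, hk⟩ := hf.exists_hasLocalDegree
  rwa [hk.localDegree_eq]

theorem localDegree_congr {f g : E → E} {p : E} (hg : IsLocalHomeoGerm g p)
    (h : f =ᶠ[𝓝 p] g) : localDegree f p = localDegree g p :=
  (hg.hasLocalDegree.congr h).localDegree_eq

theorem localDegree_comp {g f : E → E} {p : E} (hg : IsLocalHomeoGerm g (f p))
    (hf : IsLocalHomeoGerm f p) :
    localDegree (g ∘ f) p = localDegree g (f p) * localDegree f p :=
  (hf.hasLocalDegree.comp hg.hasLocalDegree).localDegree_eq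

theorem IsLocalHomeoGerm.eventually_localDegree_eq {f : E → E} {p : E}
    (hf : IsLocalHomeoGerm f p) : ∀ᶠ q in 𝓝 p, localDegree f q = localDegree f p :=
  hf.hasLocalDegree.eventually.mono fun _ h => h.localDegree_eq

theorem OpenPartialHomeomorph.preservesOrientationAt_iff_localDegree
    {e : OpenPartialHomeomorph E E} {p : E} (hp : p ∈ e.source) :
    e.PreservesOrientationAt p ↔ localDegree e p = 1 := by
  rw [e.preservesOrientationAt_iff hp]
  exact ⟨fun h => h.localDegree_eq, fun h => h ▸ (e.isLocalHomeoGerm hp).hasLocalDegree⟩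

/-- The map is its own smooth approximation, with a single regular preimage. -/
theorem localDegree_continuousLinearEquiv (A : E ≃L[ℝ] E) (p : E) :
    localDegree A p = SignType.sign (A : E →L[ℝ] E).det := by
  have hdet : (A : E →L[ℝ] E).det ≠ 0 := A.toLinearEquiv.isUnit_det'.ne_zero
  refine HasLocalDegree.localDegree_eq ⟨1, one_pos, A.continuous.continuousOn,
    A.injective.injOn, A, A.contDiff, fun x _ z hz => ?_, fun x _ _ => ?_, ?_⟩
  · rw [dist_self, dist_pos]
    intro h
    rw [A.injective h, frontier_ball _ one_ne_zero] at hz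
    simp at hz
  · rw [A.fderiv]
    exact hdet
  · have : {x | x ∈ Metric.ball p 1 ∧ A x = A p} = {p} := by
      ext x
      simp only [mem_ofPred_eq, mem_singleton_iff, A.injective.eq_iff]
      exact ⟨fun h => h.2, fun h => ⟨by simp [h], h⟩⟩
    rw [this, finsum_mem_singleton, A.fderiv]

theorem localDegree_id (p : E) : localDegree (id : E → E) p = 1 := by
  have := localDegree_continuousLinearEquiv (ContinuousLinearEquiv.refl ℝ E) p
  simpa [ContinuousLinearMap.det] using this

/-- Multiplicativity applied to a local inverse makes the degree a unit of ℤ. -/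
theorem IsLocalHomeoGerm.localDegree_eq_or {f : E → E} {p : E} (hf : IsLocalHomeoGerm f p) :
    localDegree f p = 1 ∨ localDegree f p = -1 := by
  have hf' := hf
  obtain ⟨e, hp, he⟩ := hf'
  have hg : IsLocalHomeoGerm e.symm (f p) := by
    rw [he.eq_of_nhds]
    exact e.symm.isLocalHomeoGerm (e.map_source hp)
  have h1 := localDegree_comp hg hf
  have h2 : e.symm ∘ f =ᶠ[𝓝 p] id := by
    filter_upwards [he, e.open_source.mem_nhds hp] with x hx hxs
    simp [hx, e.left_inv hxs]
  rw [localDegree_congr (isLocalHomeoGerm_id p) h2, localDegree_id] at h1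
  exact Int.isUnit_iff.1 (IsUnit.of_mul_eq_one _ (by rw [mul_comm]; exact h1.symm))

end LocalDegree

/-! ### The local degree of a product with an identity map -/

section Product

variable {E E₁ E₂ : Type*} [NormedAddCommGroup E] [NormedSpace ℝ E] [FiniteDimensional ℝ E]
  [NormedAddCommGroup E₁] [NormedSpace ℝ E₁] [FiniteDimensional ℝ E₁]
  [NormedAddCommGroup E₂] [NormedSpace ℝ E₂] [FiniteDimensional ℝ E₂]

/-- The map `f × id`, transported along a linear isomorphism. -/
def firstFactorMap (B : E ≃L[ℝ] E₁ × E₂) (f : E₁ → E₁) (x : E) : E :=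
  B.symm (f (B x).1, (B x).2)

theorem contDiff_firstFactorMap (B : E ≃L[ℝ] E₁ × E₂) {g : E₁ → E₁} (hg : ContDiff ℝ ∞ g) :
    ContDiff ℝ ∞ (firstFactorMap B g) :=
  B.symm.contDiff.comp ((hg.comp (contDiff_fst.comp B.contDiff)).prodMk
    (contDiff_snd.comp B.contDiff))

theorem det_fderiv_firstFactorMap (B : E ≃L[ℝ] E₁ × E₂) {g : E₁ → E₁} (hg : ContDiff ℝ ∞ g)
    (x : E) : (fderiv ℝ (firstFactorMap B g) x).det = (fderiv ℝ g (B x).1).det := by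
  have h1 : HasFDerivAt g (fderiv ℝ g (B x).1) (B x).1 :=
    (hg.differentiable (by simp) _).hasFDerivAt
  have h2 : HasFDerivAt (Prod.map g (id : E₂ → E₂))
      ((fderiv ℝ g (B x).1).prodMap (ContinuousLinearMap.id ℝ E₂)) (B x) :=
    HasFDerivAt.prodMap (B x) h1 (hasFDerivAt_id _)
  have h3 := B.symm.hasFDerivAt.comp x (h2.comp x B.hasFDerivAt)
  have h4 : (B.symm ∘ Prod.map g (id : E₂ → E₂) ∘ B) = firstFactorMap B g := rfl
  rw [h4] at h3
  rw [h3.fderiv]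
  have h5 := LinearMap.det_conj
    (((fderiv ℝ g (B x).1).prodMap (ContinuousLinearMap.id ℝ E₂) : E₁ × E₂ →L[ℝ] E₁ × E₂) :
      E₁ × E₂ →ₗ[ℝ] E₁ × E₂) B.symm.toLinearEquiv
  have h6 := LinearMap.det_prodMap ((fderiv ℝ g (B x).1 : E₁ →L[ℝ] E₁) : E₁ →ₗ[ℝ] E₁)
    (LinearMap.id : E₂ →ₗ[ℝ] E₂)
  rw [LinearMap.det_id, mul_one] at h6
  exact h5.trans h6

variable [MeasureSpace E₁] [BorelSpace E₁] [(volume : Measure E₁).IsAddHaarMeasure]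

/-- If g approximates f, then g × id approximates f × id with the same Jacobian determinant, and its
fibre lies in the slice through p because the second coordinate is preserved. The two signed counts
agree term by term. -/
theorem HasLocalDegree.firstFactorMap (B : E ≃L[ℝ] E₁ × E₂) {f : E₁ → E₁} {p : E} {k : ℤ}
    (hk : HasLocalDegree f (B p).1 k) : HasLocalDegree (firstFactorMap B f) p k := by
  obtain ⟨r₁, hr₁, hc, hi, hd⟩ := hk
  have hB1 : Continuous fun x => (B x).1 := continuous_fst.comp B.continuous
  have hB2 : Continuous fun x => (B x).2 := continuous_snd.comp B.continuous
  obtain ⟨r, hr, hball⟩ := Metric.nhds_basis_closedBall.mem_iff.1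
    (hB1.continuousAt.preimage_mem_nhds (Metric.ball_mem_nhds (B p).1 hr₁))
  have hm : MapsTo (fun x => (B x).1) (Metric.closedBall p r) (Metric.closedBall (B p).1 r₁) :=
    fun x hx => Metric.ball_subset_closedBall (hball hx)
  have hFc : ContinuousOn (_root_.firstFactorMap B f) (Metric.closedBall p r) :=
    B.symm.continuous.comp_continuousOn
      ((hc.comp hB1.continuousOn hm).prodMk hB2.continuousOn)
  have hFi : InjOn (_root_.firstFactorMap B f) (Metric.closedBall p r) := by
    intro x hx z hz hxz
    have h := B.symm.injective hxz
    rw [Prod.mk.injEq] at h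
    exact B.injective (Prod.ext (hi (hm hx) (hm hz) h.1) h.2)
  refine ⟨r, hr, hFc, hFi, ?_⟩
  obtain ⟨δ, hδ, hF⟩ := exists_pos_le_dist_frontier_ball (Metric.mem_ball_self hr) hFc hFi
  set j : E₁ → E := fun a => B.symm (a, (B p).2) with hj
  have hjc : Continuous j := B.symm.continuous.comp (by fun_prop)
  have hji : Function.Injective j := fun a b h => congrArg Prod.fst (B.symm.injective h)
  have hBj : ∀ a, B (j a) = (a, (B p).2) := fun a => B.apply_symm_apply _
  have hjp : j (B p).1 = p := B.symm_apply_apply p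
  -- The slice of the ball through p need not be a ball of E₁, so excision is used to move the
  -- degree of f to it.
  set U : Set E₁ := j ⁻¹' Metric.ball p r with hU
  have hUo : IsOpen U := Metric.isOpen_ball.preimage hjc
  have hUs : U ⊆ Metric.ball (B p).1 r₁ := by
    intro a ha
    have : (B (j a)).1 ∈ Metric.ball (B p).1 r₁ := hball (Metric.ball_subset_closedBall ha)
    rwa [hBj] at this
  have hpU : (B p).1 ∈ U := by
    rw [hU, mem_preimage, hjp]
    exact Metric.mem_ball_self hr
  have hUb : Bornology.IsBounded U := Metric.isBounded_ball.subset hUs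
  have hclU : closure U ⊆ Metric.closedBall (B p).1 r₁ :=
    (closure_mono hUs).trans Metric.closure_ball_subset_closedBall
  have hfz : ∀ z ∈ Metric.closedBall (B p).1 r₁ \ U, f z ≠ f (B p).1 := by
    rintro z ⟨hz, hzU⟩ h
    exact hzU (hi hz (Metric.mem_closedBall_self hr₁.le) h ▸ hpU)
  obtain ⟨δ₁, hδ₁, hf₁⟩ := ((isCompact_closedBall (B p).1 r₁).diff hUo).exists_pos_le_dist
    (hc.mono sdiff_subset) hfz
  obtain ⟨K, hK⟩ : ∃ K, LipschitzWith K B.symm := ⟨_, B.symm.lipschitz⟩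
  -- The bound δ₁ makes g a valid witness for f on U; δ / (K + 1) keeps g × id within δ of f × id
  -- after applying `B.symm`, with K + 1 since K may be zero.
  obtain ⟨g, hg, hgf, hreg⟩ := exists_contDiff_dist_lt_regular (isCompact_closedBall (B p).1 r₁)
    hc (f (B p).1) (e := min δ₁ (δ / (K + 1))) (by positivity)
  have hdeg : HasBrouwerDegree f U (f (B p).1)
      (∑ᶠ a ∈ {a | a ∈ U ∧ g a = f (B p).1},
        ((SignType.sign (fderiv ℝ g a).det : SignType) : ℤ)) := by
    refine ⟨g, hg, fun x hx z hz => ?_, fun x _ => hreg x, rfl⟩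
    rw [hUo.frontier_eq] at hz
    exact ((hgf x (hclU hx)).trans_le (min_le_left _ _)).trans_le (hf₁ z ⟨hclU hz.1, hz.2⟩)
  obtain ⟨δ₂, hδ₂, hf₂⟩ := exists_pos_le_dist_frontier_ball (Metric.mem_ball_self hr₁) hc hi
  have hkeq := hd.eq_of_subset Metric.isOpen_ball hUo Metric.isBounded_ball hUs
    (by rwa [closure_ball _ hr₁.ne']) hdeg hδ₂ hf₂ (by rw [dist_self]; positivity)
    (by rwa [closure_ball _ hr₁.ne'])
  refine ⟨_root_.firstFactorMap B g, contDiff_firstFactorMap B hg, fun x hx z hz => ?_,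
    fun x hx hxy => ?_, ?_⟩
  · rw [closure_ball p hr.ne'] at hx
    refine lt_of_lt_of_le ?_ (hF z hz)
    have h1 : dist (_root_.firstFactorMap B g x) (_root_.firstFactorMap B f x) ≤
        K * dist (g (B x).1) (f (B x).1) := by
      refine (hK.dist_le_mul _ _).trans_eq ?_
      rw [Prod.dist_eq, dist_self, max_eq_left dist_nonneg]
    have h2 := (hgf _ (hm hx)).trans_le (min_le_right _ _)
    rw [lt_div_iff₀ (by positivity)] at h2
    have h3 : (0 : ℝ) ≤ dist (g (B x).1) (f (B x).1) := dist_nonneg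
    rcases h3.eq_or_lt with h0 | h0
    · rw [← h0, mul_zero] at h1
      exact h1.trans_lt hδ
    · nlinarith
  · rw [det_fderiv_firstFactorMap B hg]
    exact hreg _ (congrArg Prod.fst (B.symm.injective hxy))
  · rw [hkeq]
    have himg : {x | x ∈ Metric.ball p r ∧
        _root_.firstFactorMap B g x = _root_.firstFactorMap B f p} =
        j '' {a | a ∈ U ∧ g a = f (B p).1} := by
      ext x
      constructor
      · rintro ⟨hx, hxy⟩
        have h := B.symm.injective hxy
        rw [Prod.mk.injEq] at h
        have hjx : j (B x).1 = x := by
          rw [hj, ← h.2]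
          exact B.symm_apply_apply x
        exact ⟨(B x).1, ⟨by rw [hU, mem_preimage, hjx]; exact hx, h.1⟩, hjx⟩
      · rintro ⟨a, ⟨ha, hga⟩, rfl⟩
        refine ⟨ha, ?_⟩
        simp only [_root_.firstFactorMap, hBj, hga]
    rw [himg, finsum_mem_image hji.injOn]
    refine finsum_mem_congr rfl fun a _ => ?_
    rw [det_fderiv_firstFactorMap B hg, hBj]

end Product

/-! ### Product maps and block permutations of ℝⁿᵈ -/

section Blocks

/-- The linear isomorphism `ℝⁿᵈ ≃ (ℝᵈ)ⁿ`. -/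
noncomputable def blockEquiv (n d : ℕ) :
    EuclideanSpace ℝ (Fin (n * d)) ≃L[ℝ] (Fin n → EuclideanSpace ℝ (Fin d)) :=
  LinearEquiv.toContinuousLinearEquiv
    { toFun := fun x i => WithLp.toLp 2 fun j => x (finProdFinEquiv (i, j))
      invFun := fun w => WithLp.toLp 2 fun k =>
        w (finProdFinEquiv.symm k).1 (finProdFinEquiv.symm k).2
      map_add' := fun x y => by ext; simp
      map_smul' := fun c x => by ext; simp
      left_inv := fun x => by ext k; simp only [Prod.mk.eta, Equiv.apply_symm_apply]
      right_inv := fun w => by ext i j; simp only [Equiv.symm_apply_apply] }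

variable {n d : ℕ}

/-- The map `f₁ × ⋯ × fₙ` on `ℝⁿᵈ`. -/
noncomputable def blockMap (f : Fin n → EuclideanSpace ℝ (Fin d) → EuclideanSpace ℝ (Fin d))
    (x : EuclideanSpace ℝ (Fin (n * d))) : EuclideanSpace ℝ (Fin (n * d)) :=
  (blockEquiv n d).symm fun i => f i (blockEquiv n d x i)

theorem isLocalHomeoGerm_pi {ι : Type*} [Finite ι] {X Y : ι → Type*} [∀ i, TopologicalSpace (X i)]
    [∀ i, TopologicalSpace (Y i)] {f : ∀ i, X i → Y i} {p : ∀ i, X i}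
    (hf : ∀ i, IsLocalHomeoGerm (f i) (p i)) :
    IsLocalHomeoGerm (fun (x : ∀ i, X i) i => f i (x i)) p := by
  choose e hp he using hf
  refine ⟨OpenPartialHomeomorph.pi e, fun i _ => hp i, ?_⟩
  have : ∀ᶠ x in 𝓝 p, ∀ i, f i (x i) = e i (x i) :=
    eventually_all.2 fun i => (continuous_apply i).continuousAt.eventually (he i)
  filter_upwards [this] with x hx
  exact funext hx

theorem isLocalHomeoGerm_blockMap
    {f : Fin n → EuclideanSpace ℝ (Fin d) → EuclideanSpace ℝ (Fin d)}
    {p : EuclideanSpace ℝ (Fin (n * d))} (hf : ∀ i, IsLocalHomeoGerm (f i) (blockEquiv n d p i)) :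
    IsLocalHomeoGerm (blockMap f) p :=
  ((blockEquiv n d).symm.toHomeomorph.isLocalHomeoGerm _).comp
    ((isLocalHomeoGerm_pi hf).comp ((blockEquiv n d).toHomeomorph.isLocalHomeoGerm p))

/-- Splitting off the `i`-th factor of a finite power. -/
noncomputable def splitFactor (n d : ℕ) (i : Fin n) :
    (Fin n → EuclideanSpace ℝ (Fin d)) ≃L[ℝ]
      EuclideanSpace ℝ (Fin d) × ({j // j ≠ i} → EuclideanSpace ℝ (Fin d)) :=
  LinearEquiv.toContinuousLinearEquiv
    { Equiv.piSplitAt i fun _ => EuclideanSpace ℝ (Fin d) with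
      map_add' := fun _ _ => rfl
      map_smul' := fun _ _ => rfl }

theorem localDegree_blockMap_update
    {g : EuclideanSpace ℝ (Fin d) → EuclideanSpace ℝ (Fin d)} (i : Fin n)
    {p : EuclideanSpace ℝ (Fin (n * d))} (hg : IsLocalHomeoGerm g (blockEquiv n d p i)) :
    localDegree (blockMap (Function.update (fun _ => id) i g)) p =
      localDegree g (blockEquiv n d p i) := by
  have h := HasLocalDegree.firstFactorMap ((blockEquiv n d).trans (splitFactor n d i)) (p := p)
    hg.hasLocalDegree
  have he : firstFactorMap ((blockEquiv n d).trans (splitFactor n d i)) g =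
      blockMap (Function.update (fun _ => id) i g) := by
    ext1 x
    change (blockEquiv n d).symm _ = (blockEquiv n d).symm _
    congr 1
    ext1 j
    change (Equiv.piSplitAt i fun _ => EuclideanSpace ℝ (Fin d)).symm
      (g (blockEquiv n d x i), fun k => blockEquiv n d x k) j = _
    rcases eq_or_ne j i with rfl | hj
    · simp [Equiv.piSplitAt]
    · simp [Equiv.piSplitAt, hj]
  rw [← he]
  exact h.localDegree_eq

/-- The local degree of a product map is the product of the local degrees. -/
theorem localDegree_blockMap
    {f : Fin n → EuclideanSpace ℝ (Fin d) → EuclideanSpace ℝ (Fin d)}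
    {p : EuclideanSpace ℝ (Fin (n * d))} (hf : ∀ i, IsLocalHomeoGerm (f i) (blockEquiv n d p i)) :
    localDegree (blockMap f) p = ∏ i, localDegree (f i) (blockEquiv n d p i) := by
  classical
  -- The factors are switched on one at a time. A newly switched factor acts on a coordinate
  -- untouched so far, so it is evaluated at the original point.
  have key : ∀ s : Finset (Fin n),
      localDegree (blockMap fun i => if i ∈ s then f i else id) p =
        ∏ i ∈ s, localDegree (f i) (blockEquiv n d p i) := by
    intro s
    induction s using Finset.induction_on with
    | empty =>
      have : (blockMap fun i : Fin n =>
          if i ∈ (∅ : Finset (Fin n)) then f i else id) = id := by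
        ext1 x
        simp [blockMap]
      rw [this, localDegree_id, Finset.prod_empty]
    | insert i s his ih =>
      have hgerm : ∀ j, IsLocalHomeoGerm (if j ∈ s then f j else id) (blockEquiv n d p j) := by
        intro j
        split_ifs
        · exact hf j
        · exact isLocalHomeoGerm_id _
      have hval : blockEquiv n d (blockMap (fun i => if i ∈ s then f i else id) p) i =
          blockEquiv n d p i := by
        simp [blockMap, his]
      have hcomp : (blockMap fun j => if j ∈ insert i s then f j else id) =
          blockMap (Function.update (fun _ => id) i (f i)) ∘
            blockMap fun j => if j ∈ s then f j else id := by
        ext1 x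
        simp only [Function.comp, blockMap, ContinuousLinearEquiv.apply_symm_apply]
        congr 1
        ext1 j
        rcases eq_or_ne j i with rfl | hj
        · simp [his]
        · simp [hj]
      have hg : IsLocalHomeoGerm (f i)
          (blockEquiv n d (blockMap (fun i => if i ∈ s then f i else id) p) i) := by
        rw [hval]; exact hf i
      have hgb : IsLocalHomeoGerm (blockMap (Function.update (fun _ => id) i (f i)))
          (blockMap (fun i => if i ∈ s then f i else id) p) := by
        refine isLocalHomeoGerm_blockMap fun j => ?_
        rcases eq_or_ne j i with rfl | hj
        · simpa using hg
        · simpa [hj] using isLocalHomeoGerm_id _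
      rw [hcomp, localDegree_comp hgb (isLocalHomeoGerm_blockMap hgerm),
        localDegree_blockMap_update i hg, hval, ih, Finset.prod_insert his]
  simpa using key Finset.univ

/-- Permutation of the blocks of `ℝⁿᵈ`. -/
noncomputable def blockPerm (d : ℕ) (σ : Equiv.Perm (Fin n)) :
    EuclideanSpace ℝ (Fin (n * d)) ≃L[ℝ] EuclideanSpace ℝ (Fin (n * d)) :=
  (blockEquiv n d).trans
    ((ContinuousLinearEquiv.piCongrLeft ℝ (fun _ => EuclideanSpace ℝ (Fin d)) σ.symm).trans
      (blockEquiv n d).symm)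

theorem blockEquiv_blockPerm (σ : Equiv.Perm (Fin n)) (x : EuclideanSpace ℝ (Fin (n * d)))
    (i : Fin n) : blockEquiv n d (blockPerm d σ x) i = blockEquiv n d x (σ i) := by
  simp only [blockPerm, ContinuousLinearEquiv.trans_apply, ContinuousLinearEquiv.apply_symm_apply]
  have := Equiv.piCongrLeft_apply_apply (fun _ => EuclideanSpace ℝ (Fin d)) σ.symm
    (blockEquiv n d x) (σ i)
  rw [Equiv.symm_apply_apply] at this
  exact this

/-- After reindexing by pairs, a block permutation is the permutation matrix of d parallel copies of
σ, one for each coordinate of ℝᵈ. -/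
theorem det_blockPerm (σ : Equiv.Perm (Fin n)) :
    (blockPerm d σ : EuclideanSpace ℝ (Fin (n * d)) →L[ℝ] EuclideanSpace ℝ (Fin (n * d))).det =
      ((Equiv.Perm.sign σ : ℤ) : ℝ) ^ d := by
  let C : EuclideanSpace ℝ (Fin (n * d)) ≃ₗ[ℝ] (Fin n × Fin d → ℝ) :=
    (WithLp.linearEquiv 2 ℝ (Fin (n * d) → ℝ)).trans
      (LinearEquiv.funCongrLeft ℝ ℝ finProdFinEquiv)
  let τ : Equiv.Perm (Fin n × Fin d) := Equiv.prodCongrLeft fun _ => σ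
  have h := LinearMap.det_conj ((blockPerm d σ :
    EuclideanSpace ℝ (Fin (n * d)) →L[ℝ] EuclideanSpace ℝ (Fin (n * d))) :
    EuclideanSpace ℝ (Fin (n * d)) →ₗ[ℝ] EuclideanSpace ℝ (Fin (n * d))) C
  have h2 : (C : EuclideanSpace ℝ (Fin (n * d)) →ₗ[ℝ] (Fin n × Fin d → ℝ)) ∘ₗ
      ((blockPerm d σ : EuclideanSpace ℝ (Fin (n * d)) →L[ℝ] EuclideanSpace ℝ (Fin (n * d))) :
      EuclideanSpace ℝ (Fin (n * d)) →ₗ[ℝ] EuclideanSpace ℝ (Fin (n * d))) ∘ₗ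
      (C.symm : (Fin n × Fin d → ℝ) →ₗ[ℝ] EuclideanSpace ℝ (Fin (n * d))) =
      Matrix.toLin' (τ.permMatrix ℝ) := by
    refine LinearMap.ext fun w => ?_
    ext ⟨i, j⟩
    have hC : ∀ y i j, C y (i, j) = blockEquiv n d y i j := fun _ _ _ => rfl
    change C (blockPerm d σ (C.symm w)) (i, j) = _
    rw [hC, blockEquiv_blockPerm, ← hC, LinearEquiv.apply_symm_apply, Matrix.toLin'_apply,
      Matrix.permMatrix_mulVec]
    rfl
  rw [h2, LinearMap.det_toLin', Matrix.det_permutation, Equiv.Perm.sign_prodCongrLeft] at h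
  rw [ContinuousLinearMap.det, ← h]
  simp

theorem localDegree_blockPerm (σ : Equiv.Perm (Fin n)) (p : EuclideanSpace ℝ (Fin (n * d))) :
    localDegree (blockPerm d σ) p = (Equiv.Perm.sign σ : ℤ) ^ d := by
  rw [localDegree_continuousLinearEquiv, det_blockPerm]
  rcases Int.units_eq_one_or (Equiv.Perm.sign σ) with h | h
  · simp [h]
  · rcases d.even_or_odd with hd | hd <;> simp [h, hd]

end Blocks

/-! ### The quotient map to the braid space -/

section BraidQuotient

variable {M : Type*} {n : ℕ}

/-- The quotient map from ordered to unordered configurations. -/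
def BraidSpace.mk (x : OrderedConf M n) : BraidSpace M n :=
  Quotient.mk (OrderedConf.setoid M n) x

theorem BraidSpace.mk_eq_mk {x y : OrderedConf M n} :
    BraidSpace.mk x = BraidSpace.mk y ↔ ∃ σ : Equiv.Perm (Fin n), ∀ i, y.1 i = x.1 (σ i) :=
  Quotient.eq (r := OrderedConf.setoid M n)

open Classical in
/-- The quotient map to the braid space, extended by `b₀` to tuples with repetitions. -/
noncomputable def toBraid (b₀ : BraidSpace M n) (x : Fin n → M) : BraidSpace M n :=
  if h : Function.Injective x then BraidSpace.mk ⟨x, h⟩ else b₀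

theorem toBraid_of_injective (b₀ : BraidSpace M n) {x : Fin n → M} (h : Function.Injective x) :
    toBraid b₀ x = BraidSpace.mk ⟨x, h⟩ :=
  dif_pos h

theorem toBraid_eq_iff (b₀ : BraidSpace M n) {x y : Fin n → M} (hx : Function.Injective x)
    (hy : Function.Injective y) :
    toBraid b₀ x = toBraid b₀ y ↔ ∃ σ : Equiv.Perm (Fin n), y = x ∘ σ := by
  rw [toBraid_of_injective b₀ hx, toBraid_of_injective b₀ hy]
  refine BraidSpace.mk_eq_mk.trans ?_
  exact exists_congr fun σ => ⟨fun h => funext h, fun h i => congrFun h i⟩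

theorem toBraid_comp_perm (b₀ : BraidSpace M n) (x : Fin n → M) (σ : Equiv.Perm (Fin n)) :
    toBraid b₀ (x ∘ σ) = toBraid b₀ x := by
  by_cases hx : Function.Injective x
  · exact ((toBraid_eq_iff b₀ hx (hx.comp σ.injective)).2 ⟨σ, rfl⟩).symm
  · have : ¬ Function.Injective (x ∘ σ) := fun h => hx (by
      have := h.comp σ.symm.injective
      rwa [Function.comp_assoc, Equiv.self_comp_symm, Function.comp_id] at this)
    have h1 : toBraid b₀ (x ∘ σ) = b₀ := dif_neg this
    have h2 : toBraid b₀ x = b₀ := dif_neg hx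
    rw [h1, h2]

theorem exists_toBraid_eq (b₀ β : BraidSpace M n) :
    ∃ x, Function.Injective x ∧ toBraid b₀ x = β := by
  obtain ⟨⟨x, hx⟩, rfl⟩ := Quotient.exists_rep β
  exact ⟨x, hx, toBraid_of_injective b₀ hx⟩

variable [TopologicalSpace M]

theorem BraidSpace.isQuotientMap_mk : IsQuotientMap (BraidSpace.mk : OrderedConf M n → _) :=
  isQuotientMap_quot_mk

/-- The saturation of an open set is the union of its translates under permutations, each of them
open. -/
theorem isOpen_toBraid_image (b₀ : BraidSpace M n) {V : Set (Fin n → M)} (hV : IsOpen V)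
    (hi : ∀ x ∈ V, Function.Injective x) : IsOpen (toBraid b₀ '' V) := by
  refine BraidSpace.isQuotientMap_mk.isOpen_preimage.1 ?_
  have : (BraidSpace.mk : OrderedConf M n → _) ⁻¹' (toBraid b₀ '' V) =
      ⋃ σ : Equiv.Perm (Fin n), {w : OrderedConf M n | w.1 ∘ σ ∈ V} := by
    ext w
    have hw : BraidSpace.mk w = toBraid b₀ w.1 :=
      (toBraid_of_injective b₀ w.2).symm
    rw [mem_preimage, hw, mem_iUnion]
    constructor
    · rintro ⟨x, hx, hxw⟩
      obtain ⟨σ, rfl⟩ := (toBraid_eq_iff b₀ w.2 (hi x hx)).1 hxw.symm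
      exact ⟨σ, hx⟩
    · rintro ⟨σ, hσ⟩
      exact ⟨w.1 ∘ σ, hσ, toBraid_comp_perm b₀ w.1 σ⟩
  rw [this]
  refine isOpen_iUnion fun σ => hV.preimage ?_
  exact continuous_pi fun i => (continuous_apply (σ i)).comp continuous_subtype_val

theorem continuousOn_toBraid (b₀ : BraidSpace M n) {V : Set (Fin n → M)}
    (hi : ∀ x ∈ V, Function.Injective x) : ContinuousOn (toBraid b₀) V := by
  rw [continuousOn_iff_continuous_domRestrict]
  have : V.domRestrict (toBraid b₀) = fun x : V =>
      BraidSpace.mk ⟨x.1, hi x.1 x.2⟩ :=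
    funext fun x => toBraid_of_injective b₀ (hi x.1 x.2)
  rw [this]
  exact BraidSpace.isQuotientMap_mk.continuous.comp
    (continuous_subtype_val.subtype_mk _)

variable [T2Space M]

/-- The quotient map to the braid space is a local homeomorphism at each configuration. -/
theorem exists_openPartialHomeomorph_toBraid (b₀ : BraidSpace M n) {x : Fin n → M}
    (hx : Function.Injective x) :
    ∃ e : OpenPartialHomeomorph (Fin n → M) (BraidSpace M n), x ∈ e.source ∧
      e = toBraid b₀ ∧ ∀ y ∈ e.source, Function.Injective y := by
  -- Disjoint neighbourhoods of the n points: a tuple with its i-th point in the i-th neighbourhood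
  -- is injective, and no nontrivial permutation of it has this property, so the quotient map is
  -- injective on their product.
  obtain ⟨T, hT, hTd⟩ := (finite_range x).t2_separation
  set V : Set (Fin n → M) := univ.pi fun i => T (x i) with hV
  have hVo : IsOpen V := isOpen_set_pi finite_univ fun i _ => (hT (x i)).2
  have hdisj : ∀ i j z, z ∈ T (x i) → z ∈ T (x j) → i = j := by
    intro i j z hi hj
    by_contra hij
    exact disjoint_left.1 (hTd (mem_range_self i) (mem_range_self j) fun h => hij (hx h)) hi hj
  have hVi : ∀ y ∈ V, Function.Injective y := by
    intro y hy i j hij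
    exact hdisj i j (y i) (hy i trivial) (hij ▸ hy j trivial)
  have hinj : InjOn (toBraid b₀) V := by
    intro y hy z hz hyz
    obtain ⟨σ, rfl⟩ := (toBraid_eq_iff b₀ (hVi y hy) (hVi z hz)).1 hyz
    have : ∀ i, σ i = i := fun i => hdisj _ _ _ (hy (σ i) trivial) (hz i trivial)
    ext i
    simp [this i]
  have hne : Nonempty (Fin n → M) := ⟨x⟩
  refine ⟨OpenPartialHomeomorph.ofContinuousOpenRestrict (hinj.toPartialEquiv (toBraid b₀) V)
    (continuousOn_toBraid b₀ hVi) ?_ hVo, fun i _ => (hT (x i)).1, rfl, hVi⟩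
  intro W hW
  have h1 : IsOpen ((↑) '' W : Set (Fin n → M)) := hVo.isOpenMap_subtype_val W hW
  have h2 := isOpen_toBraid_image b₀ h1 (by rintro _ ⟨w, -, rfl⟩; exact hVi w.1 w.2)
  rwa [image_image] at h2

theorem isLocalHomeoGerm_toBraid (b₀ : BraidSpace M n) {x : Fin n → M}
    (hx : Function.Injective x) : IsLocalHomeoGerm (toBraid b₀) x := by
  obtain ⟨e, hxe, he, -⟩ := exists_openPartialHomeomorph_toBraid b₀ hx
  exact he ▸ e.isLocalHomeoGerm hxe

end BraidQuotient

/-! ### Orientability in terms of transition signs -/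

section TransitionDegree

variable {X : Type*} [TopologicalSpace X] {d : ℕ}

/-- The local degree, at (the image of) `x`, of the transition map from `φ` to `ψ`. -/
noncomputable def transitionDegree
    (φ ψ : OpenPartialHomeomorph X (EuclideanSpace ℝ (Fin d))) (x : X) : ℤ :=
  localDegree (ψ ∘ φ.symm) (φ x)

theorem isLocalHomeoGerm_transition
    {φ ψ : OpenPartialHomeomorph X (EuclideanSpace ℝ (Fin d))} {x : X} (hφ : x ∈ φ.source)
    (hψ : x ∈ ψ.source) : IsLocalHomeoGerm (ψ ∘ φ.symm) (φ x) := by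
  refine IsLocalHomeoGerm.comp ?_ (φ.symm.isLocalHomeoGerm (φ.map_source hφ))
  rw [φ.left_inv hφ]
  exact ψ.isLocalHomeoGerm hψ

/-- Indexing by points of X instead of chart coordinates lets signs be compared across several
charts at one point. -/
theorem isOrientableManifold_iff : IsOrientableManifold d X ↔
    ∃ A : Set (OpenPartialHomeomorph X (EuclideanSpace ℝ (Fin d))),
      (∀ x : X, ∃ φ ∈ A, x ∈ φ.source) ∧
      ∀ φ ∈ A, ∀ ψ ∈ A, ∀ x, x ∈ φ.source → x ∈ ψ.source → transitionDegree φ ψ x = 1 := by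
  refine exists_congr fun A => and_congr_right fun _ => ?_
  refine forall₂_congr fun φ _ => forall₂_congr fun ψ _ => ⟨fun h x hφ hψ => ?_, fun h p hp => ?_⟩
  · have hs : φ x ∈ (φ.symm.trans ψ).source := by
      rw [OpenPartialHomeomorph.trans_source]
      exact ⟨φ.map_source hφ, by rwa [mem_preimage, φ.left_inv hφ]⟩
    have := (OpenPartialHomeomorph.preservesOrientationAt_iff_localDegree hs).1 (h _ hs)
    rwa [OpenPartialHomeomorph.coe_trans] at this
  · rw [OpenPartialHomeomorph.preservesOrientationAt_iff_localDegree hp,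
      OpenPartialHomeomorph.coe_trans]
    rw [OpenPartialHomeomorph.trans_source] at hp
    have := h (φ.symm p) (φ.map_target hp.1) hp.2
    rwa [transitionDegree, φ.right_inv hp.1] at this

theorem eventually_transitionDegree_eq
    {φ ψ : OpenPartialHomeomorph X (EuclideanSpace ℝ (Fin d))} {x : X} (hφ : x ∈ φ.source)
    (hψ : x ∈ ψ.source) : ∀ᶠ y in 𝓝 x, transitionDegree φ ψ y = transitionDegree φ ψ x :=
  (φ.continuousAt hφ).eventually (isLocalHomeoGerm_transition hφ hψ).eventually_localDegree_eq

end TransitionDegree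

/-! ### Comparing charts of the braid space with product charts -/

section ProductCharts

variable {M : Type*} [TopologicalSpace M] {n d : ℕ}

/-- The coordinates of a tuple in a product chart. -/
noncomputable def productCoord (Φ : Fin n → OpenPartialHomeomorph M (EuclideanSpace ℝ (Fin d)))
    (x : Fin n → M) : EuclideanSpace ℝ (Fin (n * d)) :=
  (blockEquiv n d).symm fun i => Φ i (x i)

/-- A chart of the braid space read in a product chart of `Mⁿ`. -/
noncomputable def braidTransition (b₀ : BraidSpace M n)
    (c : OpenPartialHomeomorph (BraidSpace M n) (EuclideanSpace ℝ (Fin (n * d))))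
    (Φ : Fin n → OpenPartialHomeomorph M (EuclideanSpace ℝ (Fin d)))
    (v : EuclideanSpace ℝ (Fin (n * d))) : EuclideanSpace ℝ (Fin (n * d)) :=
  c (toBraid b₀ fun i => (Φ i).symm (blockEquiv n d v i))

/-- The sign comparing a chart of the braid space with a product chart of `Mⁿ` at `x`. -/
noncomputable def braidDegree (b₀ : BraidSpace M n)
    (c : OpenPartialHomeomorph (BraidSpace M n) (EuclideanSpace ℝ (Fin (n * d))))
    (Φ : Fin n → OpenPartialHomeomorph M (EuclideanSpace ℝ (Fin d))) (x : Fin n → M) : ℤ :=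
  localDegree (braidTransition b₀ c Φ) (productCoord Φ x)

variable {b₀ : BraidSpace M n}
  {c c' : OpenPartialHomeomorph (BraidSpace M n) (EuclideanSpace ℝ (Fin (n * d)))}
  {Φ Φ' : Fin n → OpenPartialHomeomorph M (EuclideanSpace ℝ (Fin d))} {x : Fin n → M}

theorem productCoord_symm (hΦ : ∀ i, x i ∈ (Φ i).source) :
    (fun i => (Φ i).symm (blockEquiv n d (productCoord Φ x) i)) = x := by
  ext i
  simp [productCoord, (Φ i).left_inv (hΦ i)]

theorem braidTransition_productCoord (hΦ : ∀ i, x i ∈ (Φ i).source) :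
    braidTransition b₀ c Φ (productCoord Φ x) = c (toBraid b₀ x) := by
  rw [braidTransition, productCoord_symm hΦ]

theorem continuousAt_productCoord (hΦ : ∀ i, x i ∈ (Φ i).source) :
    ContinuousAt (productCoord Φ) x :=
  (blockEquiv n d).symm.continuous.continuousAt.comp (continuousAt_pi.2 fun i =>
    ContinuousAt.comp (f := fun y : Fin n → M => y i) ((Φ i).continuousAt (hΦ i))
      (continuous_apply i).continuousAt)

theorem isLocalHomeoGerm_productSymm (hΦ : ∀ i, x i ∈ (Φ i).source) :
    IsLocalHomeoGerm (fun v i => (Φ i).symm (blockEquiv n d v i)) (productCoord Φ x) := by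
  refine IsLocalHomeoGerm.comp (g := fun (w : Fin n → EuclideanSpace ℝ (Fin d)) i =>
    (Φ i).symm (w i)) (f := blockEquiv n d) ?_ ((blockEquiv n d).toHomeomorph.isLocalHomeoGerm _)
  refine isLocalHomeoGerm_pi fun i => (Φ i).symm.isLocalHomeoGerm ?_
  simp [productCoord, (Φ i).map_source (hΦ i)]

variable [T2Space M]

theorem isLocalHomeoGerm_braidTransition (hΦ : ∀ i, x i ∈ (Φ i).source)
    (hx : Function.Injective x) (hc : toBraid b₀ x ∈ c.source) :
    IsLocalHomeoGerm (braidTransition b₀ c Φ) (productCoord Φ x) := by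
  refine IsLocalHomeoGerm.comp (g := c ∘ toBraid b₀) (IsLocalHomeoGerm.comp ?_ ?_)
    (isLocalHomeoGerm_productSymm hΦ) <;> rw [productCoord_symm hΦ]
  · exact c.isLocalHomeoGerm hc
  · exact isLocalHomeoGerm_toBraid b₀ hx

theorem braidDegree_eq_or (hΦ : ∀ i, x i ∈ (Φ i).source) (hx : Function.Injective x)
    (hc : toBraid b₀ x ∈ c.source) : braidDegree b₀ c Φ x = 1 ∨ braidDegree b₀ c Φ x = -1 :=
  (isLocalHomeoGerm_braidTransition hΦ hx hc).localDegree_eq_or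

theorem eventually_braidDegree_eq (hΦ : ∀ i, x i ∈ (Φ i).source) (hx : Function.Injective x)
    (hc : toBraid b₀ x ∈ c.source) :
    ∀ᶠ y in 𝓝 x, braidDegree b₀ c Φ y = braidDegree b₀ c Φ x :=
  (continuousAt_productCoord hΦ).eventually
    (isLocalHomeoGerm_braidTransition hΦ hx hc).eventually_localDegree_eq

/-- Near the point, reading in `c'` is reading in `c` followed by the transition map. -/
theorem braidDegree_change_chart (hΦ : ∀ i, x i ∈ (Φ i).source) (hx : Function.Injective x)
    (hc : toBraid b₀ x ∈ c.source) (hc' : toBraid b₀ x ∈ c'.source) :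
    braidDegree b₀ c' Φ x = transitionDegree c c' (toBraid b₀ x) * braidDegree b₀ c Φ x := by
  have hg := isLocalHomeoGerm_braidTransition hΦ hx hc
  have ht := isLocalHomeoGerm_transition hc hc'
  rw [transitionDegree, braidDegree, braidDegree, ← braidTransition_productCoord hΦ,
    ← localDegree_comp (by rwa [braidTransition_productCoord hΦ]) hg]
  refine localDegree_congr (IsLocalHomeoGerm.comp (by rwa [braidTransition_productCoord hΦ]) hg) ?_
  have h1 : ContinuousAt (toBraid b₀ ∘ fun v i => (Φ i).symm (blockEquiv n d v i))
      (productCoord Φ x) := by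
    refine (IsLocalHomeoGerm.comp ?_ (isLocalHomeoGerm_productSymm hΦ)).continuousAt
    rw [productCoord_symm hΦ]
    exact isLocalHomeoGerm_toBraid b₀ hx
  have h2 : (toBraid b₀ ∘ fun v i => (Φ i).symm (blockEquiv n d v i)) (productCoord Φ x) ∈
      c.source := by
    rw [Function.comp_apply, productCoord_symm hΦ]
    exact hc
  filter_upwards [h1 (c.open_source.mem_nhds h2)] with v hv
  exact congrArg c' (c.left_inv hv).symm

/-- The change of product coordinates is a block map, so its degree is the product of the transition
degrees of the factors. -/
theorem braidDegree_change_product (hΦ : ∀ i, x i ∈ (Φ i).source)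
    (hΦ' : ∀ i, x i ∈ (Φ' i).source) (hx : Function.Injective x)
    (hc : toBraid b₀ x ∈ c.source) :
    braidDegree b₀ c Φ x =
      braidDegree b₀ c Φ' x * ∏ i, transitionDegree (Φ i) (Φ' i) (x i) := by
  have hB : ∀ i, blockEquiv n d (productCoord Φ x) i = Φ i (x i) := fun i => by
    simp [productCoord]
  have hgi : ∀ i, IsLocalHomeoGerm (Φ' i ∘ (Φ i).symm)
      (blockEquiv n d (productCoord Φ x) i) := fun i => by
    rw [hB]; exact isLocalHomeoGerm_transition (hΦ i) (hΦ' i)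
  have hval : blockMap (fun i => Φ' i ∘ (Φ i).symm) (productCoord Φ x) = productCoord Φ' x := by
    apply (blockEquiv n d).injective
    ext1 i
    rw [blockMap, ContinuousLinearEquiv.apply_symm_apply, hB, Function.comp_apply,
      (Φ i).left_inv (hΦ i), productCoord, ContinuousLinearEquiv.apply_symm_apply]
  have hg := isLocalHomeoGerm_braidTransition hΦ' hx hc
  have hb := isLocalHomeoGerm_blockMap hgi
  have hprod : ∏ i, transitionDegree (Φ i) (Φ' i) (x i) =
      localDegree (blockMap fun i => Φ' i ∘ (Φ i).symm) (productCoord Φ x) := by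
    rw [localDegree_blockMap hgi]
    exact Finset.prod_congr rfl fun i _ => by rw [hB, transitionDegree]
  rw [hprod, braidDegree, braidDegree, ← hval,
    ← localDegree_comp (by rwa [hval]) hb]
  refine localDegree_congr (IsLocalHomeoGerm.comp (by rwa [hval]) hb) ?_
  have hev : ∀ᶠ v in 𝓝 (productCoord Φ x), ∀ i,
      (Φ i).symm (blockEquiv n d v i) ∈ (Φ' i).source := by
    refine eventually_all.2 fun i => ?_
    have hcts : ContinuousAt (fun v => (Φ i).symm (blockEquiv n d v i)) (productCoord Φ x) :=
      continuousAt_pi.1 (isLocalHomeoGerm_productSymm hΦ).continuousAt i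
    refine hcts ((Φ' i).open_source.mem_nhds ?_)
    have : (Φ i).symm (blockEquiv n d (productCoord Φ x) i) = x i :=
      congrFun (productCoord_symm hΦ) i
    change (Φ i).symm (blockEquiv n d (productCoord Φ x) i) ∈ (Φ' i).source
    rw [this]
    exact hΦ' i
  filter_upwards [hev] with v hv
  simp only [Function.comp, braidTransition, blockMap, ContinuousLinearEquiv.apply_symm_apply]
  congr 2
  ext i
  rw [(Φ' i).left_inv (hv i)]

/-- Relabelling leaves the unordered configuration fixed and acts on the coordinates by a block
permutation. This is where the parity of d enters. -/
theorem braidDegree_comp_perm (hΦ : ∀ i, x i ∈ (Φ i).source) (hx : Function.Injective x)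
    (hc : toBraid b₀ x ∈ c.source) (σ : Equiv.Perm (Fin n)) :
    braidDegree b₀ c Φ x = braidDegree b₀ c (Φ ∘ σ) (x ∘ σ) * (Equiv.Perm.sign σ : ℤ) ^ d := by
  have hval : blockPerm d σ (productCoord Φ x) = productCoord (Φ ∘ σ) (x ∘ σ) := by
    apply (blockEquiv n d).injective
    ext1 i
    rw [blockEquiv_blockPerm]
    simp [productCoord]
  have hg : IsLocalHomeoGerm (braidTransition b₀ c (Φ ∘ σ)) (productCoord (Φ ∘ σ) (x ∘ σ)) :=
    isLocalHomeoGerm_braidTransition (fun i => hΦ (σ i)) (hx.comp σ.injective)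
      (by rwa [toBraid_comp_perm])
  rw [← localDegree_blockPerm σ (productCoord Φ x), braidDegree, braidDegree, ← hval,
    ← localDegree_comp (by rwa [hval]) (f := blockPerm d σ)
      ((blockPerm d σ).toHomeomorph.isLocalHomeoGerm _)]
  congr 1
  ext1 v
  simp only [Function.comp, braidTransition, blockEquiv_blockPerm]
  rw [← toBraid_comp_perm b₀ _ σ]
  rfl

end ProductCharts

/-! ### Orienting the braid space from the manifold -/

section FromManifold

variable {M : Type*} [TopologicalSpace M] [T2Space M] {n d : ℕ}

/-- Unordered configurations in an oriented manifold of even dimension are oriented by product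
charts. -/
theorem IsOrientableManifold.braidSpace (h : IsOrientableManifold d M) (hd : Even d) :
    IsOrientableManifold (n * d) (BraidSpace M n) := by
  obtain ⟨A, hcov, hA⟩ := isOrientableManifold_iff.1 h
  rw [isOrientableManifold_iff]
  rcases isEmpty_or_nonempty (BraidSpace M n) with hE | ⟨⟨b₀⟩⟩
  · exact ⟨∅, fun x => hE.elim x, fun φ hφ => hφ.elim⟩
  choose χ hχA hχ using hcov
  -- The atlas consists of all charts that are positive against every product of charts in A;
  -- compatibility is then immediate, and the work lies in covering.
  refine ⟨{c | ∀ Φ : Fin n → OpenPartialHomeomorph M (EuclideanSpace ℝ (Fin d)),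
    (∀ i, Φ i ∈ A) → ∀ x, (∀ i, x i ∈ (Φ i).source) → Function.Injective x →
      toBraid b₀ x ∈ c.source → braidDegree b₀ c Φ x = 1}, fun β => ?_, ?_⟩
  · obtain ⟨x, hx, rfl⟩ := exists_toBraid_eq b₀ β
    obtain ⟨e, hxe, he, hinj⟩ := exists_openPartialHomeomorph_toBraid b₀ hx
    set Φ := fun i => χ (x i) with hΦ
    set c := (e.symm.trans (OpenPartialHomeomorph.pi Φ)).trans
      (blockEquiv n d).symm.toHomeomorph.toOpenPartialHomeomorph with hc
    have hcs : ∀ β, β ∈ c.source ↔ β ∈ e.target ∧ ∀ i, e.symm β i ∈ (Φ i).source := by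
      intro β
      simp [hc]
    have hcc : ∀ β, c β = productCoord Φ (e.symm β) := fun β => rfl
    refine ⟨c, fun Ψ hΨ y hyΨ hy hyc => ?_, ?_⟩
    · obtain ⟨ht, hs⟩ := (hcs _).1 hyc
      set w := e.symm (toBraid b₀ y) with hw
      have hwe : w ∈ e.source := e.map_target ht
      have hwi := hinj w hwe
      have hbw : toBraid b₀ w = toBraid b₀ y := by
        rw [← he]
        exact e.right_inv ht |>.trans (by rw [he])
      -- The tuple `y` may be ordered differently from the tuple `w` chosen by the local inverse.
      -- Reordering costs sign(σ)ᵈ, which is 1 for even d; passing from Ψ to Φ costs nothing since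
      -- all these charts lie in A.
      obtain ⟨σ, hσ⟩ := (toBraid_eq_iff b₀ hy hwi).1 hbw.symm
      have hwΨ : ∀ i, w i ∈ ((Ψ ∘ σ) i).source := fun i => by
        rw [hσ]; exact hyΨ (σ i)
      have hwc : toBraid b₀ w ∈ c.source := hbw ▸ hyc
      have hsign : (Equiv.Perm.sign σ : ℤ) ^ d = 1 := by
        rcases Int.units_eq_one_or (Equiv.Perm.sign σ) with h | h <;> simp [h, hd]
      have hprod : ∏ i, transitionDegree ((Ψ ∘ σ) i) (Φ i) (w i) = 1 :=
        Finset.prod_eq_one fun i _ => hA _ (hΨ (σ i)) _ (hχA (x i)) _ (hwΨ i) (hs i)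
      rw [braidDegree_comp_perm hyΨ hy hyc σ, hsign, mul_one, ← hσ,
        braidDegree_change_product hwΨ hs hwi hwc, hprod, mul_one]
      -- Read in the product chart from which it was built, `c` is the identity.
      have hid : braidTransition b₀ c Φ =ᶠ[𝓝 (productCoord Φ w)] id := by
        have hg := (isLocalHomeoGerm_productSymm hs).continuousAt
        have hval := productCoord_symm hs
        have hev : ∀ᶠ v in 𝓝 (productCoord Φ w),
            (fun i => (Φ i).symm (blockEquiv n d v i)) ∈ e.source := by
          refine hg.eventually (e.open_source.mem_nhds ?_)
          change (fun i => (Φ i).symm (blockEquiv n d (productCoord Φ w) i)) ∈ e.source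
          rwa [hval]
        have hev2 : ∀ᶠ v in 𝓝 (productCoord Φ w), ∀ i, blockEquiv n d v i ∈ (Φ i).target := by
          refine eventually_all.2 fun i => ?_
          have hcont : Continuous fun v => blockEquiv n d v i :=
            (continuous_apply i).comp (blockEquiv n d).continuous
          refine hcont.continuousAt.eventually ((Φ i).open_target.mem_nhds ?_)
          simpa [productCoord] using (Φ i).map_source (hs i)
        filter_upwards [hev, hev2] with v hv hv2
        rw [braidTransition, hcc, ← he, e.left_inv hv, productCoord, id]
        apply (blockEquiv n d).injective
        ext1 i
        rw [ContinuousLinearEquiv.apply_symm_apply, (Φ i).right_inv (hv2 i)]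
      rw [braidDegree, localDegree_congr (isLocalHomeoGerm_id _) hid, localDegree_id]
    · rw [hcs, ← he]
      exact ⟨e.map_source hxe, fun i => by rw [e.left_inv hxe]; exact hχ (x i)⟩
  · intro c hc c' hc' β hβ hβ'
    obtain ⟨x, hx, rfl⟩ := exists_toBraid_eq b₀ β
    have h := braidDegree_change_chart (Φ := fun i => χ (x i)) (fun i => hχ (x i)) hx hβ hβ'
    rw [hc _ (fun i => hχA (x i)) x (fun i => hχ (x i)) hx hβ,
      hc' _ (fun i => hχA (x i)) x (fun i => hχ (x i)) hx hβ', mul_one] at h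
    exact h.symm

end FromManifold

/-! ### Evenness of d and orientability of M from the braid space -/

section FromBraidSpace

variable {M : Type*} [TopologicalSpace M] [T2Space M] {n d : ℕ}

/-- An orientation of the space of ordered configurations which is compatible with permutations:
a sign for each product chart around each configuration. -/
structure ConfOrientation (M : Type*) [TopologicalSpace M] (n d : ℕ) where
  /-- The sign of a product chart at a configuration. -/
  sgn : (Fin n → OpenPartialHomeomorph M (EuclideanSpace ℝ (Fin d))) → (Fin n → M) → ℤ
  eq_or : ∀ Φ x, (∀ i, x i ∈ (Φ i).source) → Function.Injective x → sgn Φ x = 1 ∨ sgn Φ x = -1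
  eventually_eq : ∀ Φ x, (∀ i, x i ∈ (Φ i).source) → Function.Injective x →
    ∀ᶠ y in 𝓝 x, sgn Φ y = sgn Φ x
  change : ∀ Φ Φ' x, (∀ i, x i ∈ (Φ i).source) → (∀ i, x i ∈ (Φ' i).source) →
    Function.Injective x → sgn Φ x = sgn Φ' x * ∏ i, transitionDegree (Φ i) (Φ' i) (x i)
  comp_perm : ∀ Φ x, (∀ i, x i ∈ (Φ i).source) → Function.Injective x →
    ∀ σ : Equiv.Perm (Fin n), sgn Φ x = sgn (Φ ∘ σ) (x ∘ σ) * (Equiv.Perm.sign σ : ℤ) ^ d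

theorem IsOrientableManifold.nonempty_confOrientation (b₀ : BraidSpace M n)
    (h : IsOrientableManifold (n * d) (BraidSpace M n)) : Nonempty (ConfOrientation M n d) := by
  obtain ⟨A, hcov, hA⟩ := isOrientableManifold_iff.1 h
  choose χ hχA hχ using hcov
  -- The sign does not depend on the oriented chart used at the configuration. Local constancy needs
  -- this, since `χ` may choose unrelated charts at neighbouring points.
  have hS : ∀ c ∈ A, ∀ Φ : Fin n → OpenPartialHomeomorph M (EuclideanSpace ℝ (Fin d)), ∀ x,
      (∀ i, x i ∈ (Φ i).source) → Function.Injective x → toBraid b₀ x ∈ c.source →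
      braidDegree b₀ (χ (toBraid b₀ x)) Φ x = braidDegree b₀ c Φ x := by
    intro c hc Φ x hΦ hx hxc
    rw [braidDegree_change_chart hΦ hx hxc (hχ _), hA c hc _ (hχA _) _ hxc (hχ _), one_mul]
  refine ⟨⟨fun Φ x => braidDegree b₀ (χ (toBraid b₀ x)) Φ x, fun Φ x hΦ hx =>
    braidDegree_eq_or hΦ hx (hχ _), fun Φ x hΦ hx => ?_, fun Φ Φ' x hΦ hΦ' hx =>
    braidDegree_change_product hΦ hΦ' hx (hχ _), fun Φ x hΦ hx σ => ?_⟩⟩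
  · obtain ⟨e, hxe, he, hinj⟩ := exists_openPartialHomeomorph_toBraid b₀ hx
    have h1 : ∀ᶠ y in 𝓝 x, ∀ i, y i ∈ (Φ i).source := eventually_all.2 fun i =>
      (continuous_apply i).continuousAt.eventually ((Φ i).open_source.mem_nhds (hΦ i))
    have h2 : ∀ᶠ y in 𝓝 x, toBraid b₀ y ∈ (χ (toBraid b₀ x)).source :=
      (isLocalHomeoGerm_toBraid b₀ hx).continuousAt.eventually
        ((χ (toBraid b₀ x)).open_source.mem_nhds (hχ _))
    filter_upwards [h1, h2, e.open_source.mem_nhds hxe, eventually_braidDegree_eq hΦ hx (hχ _)]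
      with y hy1 hy2 hye hy
    rw [hS _ (hχA _) Φ y hy1 (hinj y hye) hy2, hy]
  · rw [toBraid_comp_perm]
    exact braidDegree_comp_perm hΦ hx (hχ _) σ

/-- A ball inside the target is stretched onto ℝᵈ, so that spheres, far away points and punctured
spaces of ℝᵈ can all be transported to M. -/
theorem exists_chart_target_univ [ChartedSpace (EuclideanSpace ℝ (Fin d)) M] (x : M) {O : Set M}
    (hO : IsOpen O) (hx : x ∈ O) :
    ∃ φ : OpenPartialHomeomorph M (EuclideanSpace ℝ (Fin d)),
      x ∈ φ.source ∧ φ.source ⊆ O ∧ φ.target = univ ∧ φ x = 0 := by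
  set ψ := (chartAt (EuclideanSpace ℝ (Fin d)) x).restrOpen O hO with hψ
  have hxψ : x ∈ ψ.source := ⟨mem_chart_source _ x, hx⟩
  have hψO : ψ.source ⊆ O := inter_subset_right
  obtain ⟨r, hr, hball⟩ := Metric.isOpen_iff.1 ψ.open_target _ (ψ.map_source hxψ)
  set β := (OpenPartialHomeomorph.univBall (ψ x) r).symm with hβ
  have hβs : β.source = Metric.ball (ψ x) r := OpenPartialHomeomorph.univBall_target _ hr
  refine ⟨ψ.trans β, ?_, ?_, ?_, ?_⟩
  · rw [OpenPartialHomeomorph.trans_source]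
    exact ⟨hxψ, by rw [mem_preimage, hβs]; exact Metric.mem_ball_self hr⟩
  · rw [OpenPartialHomeomorph.trans_source]
    exact inter_subset_left.trans hψO
  · rw [OpenPartialHomeomorph.trans_target]
    refine eq_univ_of_forall fun v => ?_
    have hv : v ∈ β.target := by
      rw [hβ, OpenPartialHomeomorph.symm_target, OpenPartialHomeomorph.univBall_source]
      trivial
    exact ⟨hv, hball (hβs ▸ β.map_target hv)⟩
  · rw [OpenPartialHomeomorph.coe_trans, Function.comp_apply, hβ,
      OpenPartialHomeomorph.univBall_symm_apply_center]

/-- A configuration in `ℝᵈ` with two antipodal points on the unit sphere, and the others far away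
on the first axis. -/
noncomputable def antipodalConf (n : ℕ) {d : ℕ} (a v : EuclideanSpace ℝ (Fin d)) (i : Fin n) :
    EuclideanSpace ℝ (Fin d) :=
  if (i : ℕ) = 0 then v else if (i : ℕ) = 1 then -v else ((i : ℕ) : ℝ) • a

/-- The remaining points have norms 2, 3, …, so they are distinct and off the unit sphere. -/
theorem antipodalConf_injective {a v : EuclideanSpace ℝ (Fin d)} (ha : ‖a‖ = 1) (hv : ‖v‖ = 1) :
    Function.Injective (antipodalConf n a v) := by
  have hv0 : v ≠ 0 := by
    rintro rfl
    simp at hv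
  have hvv : v ≠ -v := by
    intro h
    have h2 : (2 : ℝ) • v = 0 := by
      rw [two_smul]
      nth_rewrite 1 [h]
      exact neg_add_cancel v
    exact hv0 ((smul_eq_zero_iff_right two_ne_zero).1 h2)
  have hbig : ∀ k : ℕ, k ≠ 0 → k ≠ 1 → ∀ w : EuclideanSpace ℝ (Fin d), ‖w‖ = 1 →
      w ≠ (k : ℝ) • a := by
    rintro k h0 h1 w hw rfl
    rw [norm_smul, ha, mul_one, Real.norm_natCast] at hw
    exact h1 (by exact_mod_cast hw)
  have ha0 : a ≠ 0 := by
    rintro rfl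
    simp at ha
  have hnv : ‖-v‖ = 1 := by rwa [norm_neg]
  intro i j hij
  ext
  simp only [antipodalConf] at hij
  split_ifs at hij with h1 h2 h3 h4 h5 h6 h7 h8
  · omega
  · exact absurd hij hvv
  · exact absurd hij (hbig _ h2 h3 v hv)
  · exact absurd hij.symm hvv
  · omega
  · exact absurd hij (hbig _ h5 h6 _ hnv)
  · exact absurd hij.symm (hbig _ h1 h4 v hv)
  · exact absurd hij.symm (hbig _ h1 h4 _ hnv)
  · exact_mod_cast smul_left_injective ℝ ha0 hij

theorem continuous_antipodalConf (a : EuclideanSpace ℝ (Fin d)) :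
    Continuous (antipodalConf n a) := by
  refine continuous_pi fun i => ?_
  simp only [antipodalConf]
  split_ifs <;> fun_prop

theorem one_lt_rank_euclideanSpace (hd : 2 ≤ d) :
    1 < Module.rank ℝ (EuclideanSpace ℝ (Fin d)) := by
  rw [← Module.finrank_eq_rank, finrank_euclideanSpace_fin]
  exact_mod_cast hd

theorem antipodalConf_comp_swap (hn : 2 ≤ n) (a v : EuclideanSpace ℝ (Fin d)) :
    antipodalConf n a v ∘ Equiv.swap (⟨0, by omega⟩ : Fin n) ⟨1, by omega⟩ =
      antipodalConf n a (-v) := by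
  ext1 i
  rw [Function.comp_apply]
  rcases eq_or_ne i ⟨0, by omega⟩ with rfl | h0
  · rw [Equiv.swap_apply_left]
    simp [antipodalConf]
  rcases eq_or_ne i ⟨1, by omega⟩ with rfl | h1
  · rw [Equiv.swap_apply_right]
    simp [antipodalConf]
  rw [Equiv.swap_apply_of_ne_of_ne h0 h1]
  have h0' : (i : ℕ) ≠ 0 := fun h => h0 (Fin.ext h)
  have h1' : (i : ℕ) ≠ 1 := fun h => h1 (Fin.ext h)
  simp [antipodalConf, h0', h1']

/-- Exchanging two points in a chart shows that an orientation invariant under permutations forces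
the dimension to be even. -/
theorem ConfOrientation.even (S : ConfOrientation M n d) (hd : 2 ≤ d) (hn : 2 ≤ n)
    {φ : OpenPartialHomeomorph M (EuclideanSpace ℝ (Fin d))} (hφ : φ.target = univ) : Even d := by
  set a : EuclideanSpace ℝ (Fin d) := EuclideanSpace.single ⟨0, by omega⟩ 1 with ha_def
  have ha : ‖a‖ = 1 := by simp [ha_def]
  have hsymm : Continuous φ.symm := by
    rw [← continuousOn_univ, ← hφ]
    exact φ.continuousOn_symm
  have hsymm_inj : Function.Injective φ.symm := by
    intro u w h
    exact φ.symm.injOn (by simp [hφ]) (by simp [hφ]) h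
  set x : EuclideanSpace ℝ (Fin d) → Fin n → M := fun v i => φ.symm (antipodalConf n a v i)
  have hxc : Continuous x := continuous_pi fun i =>
    hsymm.comp ((continuous_apply i).comp (continuous_antipodalConf a))
  have hxs : ∀ v i, x v i ∈ ((fun _ => φ : Fin n → _) i).source := fun v i =>
    φ.map_target (by simp [hφ])
  have hxi : ∀ v, ‖v‖ = 1 → Function.Injective (x v) := fun v hv =>
    hsymm_inj.comp (antipodalConf_injective ha hv)
  have hmem : ∀ v : EuclideanSpace ℝ (Fin d), v ∈ Metric.sphere 0 1 ↔ ‖v‖ = 1 := fun v => by simp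
  have hconn := (isConnected_sphere (one_lt_rank_euclideanSpace hd)
    (0 : EuclideanSpace ℝ (Fin d)) zero_le_one).isPreconnected
  have hcont : ContinuousOn (fun v => S.sgn (fun _ => φ) (x v)) (Metric.sphere 0 1) := by
    intro v hv
    refine ContinuousAt.continuousWithinAt ?_
    exact continuousAt_const.congr (((hxc.continuousAt (x := v)).eventually
      (S.eventually_eq _ (x v) (hxs v) (hxi v ((hmem v).1 hv)))).mono fun _ h => h.symm)
  -- The unit sphere is connected because d ≥ 2, so the sign is the same at a and -a; these two
  -- configurations differ by the transposition, which contributes (-1)ᵈ.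
  have hcst := hconn.constant hcont ((hmem a).2 ha) ((hmem (-a)).2 (by rwa [norm_neg]))
  have hperm := S.comp_perm (fun _ => φ) (x a) (hxs a) (hxi a ha)
    (Equiv.swap (⟨0, by omega⟩ : Fin n) ⟨1, by omega⟩)
  have hswap : x a ∘ Equiv.swap (⟨0, by omega⟩ : Fin n) ⟨1, by omega⟩ = x (-a) := by
    ext1 i
    exact congrArg φ.symm (congrFun (antipodalConf_comp_swap hn a a) i)
  rw [hswap, Equiv.Perm.sign_swap (by simp)] at hperm
  change S.sgn (fun _ => φ) (x a) = S.sgn (fun _ => φ) (x (-a)) * _ at hperm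
  rw [← hcst] at hperm
  by_contra hodd
  rw [Nat.not_even_iff_odd] at hodd
  rcases S.eq_or (fun _ => φ) (x a) (hxs a) (hxi a ha) with h | h <;>
    simp [h, hodd.neg_one_pow] at hperm

/-- A hyperplane reflection, used to reverse a chart of the wrong sign. -/
theorem exists_continuousLinearEquiv_det_neg (hd : 2 ≤ d) :
    ∃ ρ : EuclideanSpace ℝ (Fin d) ≃L[ℝ] EuclideanSpace ℝ (Fin d), ∀ p, localDegree ρ p = -1 := by
  set a : EuclideanSpace ℝ (Fin d) := EuclideanSpace.single ⟨0, by omega⟩ 1 with ha_def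
  have ha : a ≠ 0 := by simp [ha_def]
  set K := (Submodule.span ℝ {a})ᗮ
  refine ⟨K.reflection.toContinuousLinearEquiv, fun p => ?_⟩
  rw [localDegree_continuousLinearEquiv]
  have h1 := K.det_reflection
  rw [Submodule.orthogonal_orthogonal, finrank_span_singleton ha, pow_one] at h1
  have h2 : ((K.reflection.toContinuousLinearEquiv :
      EuclideanSpace ℝ (Fin d) ≃L[ℝ] EuclideanSpace ℝ (Fin d)) :
      EuclideanSpace ℝ (Fin d) →L[ℝ] EuclideanSpace ℝ (Fin d)).det = -1 := h1
  rw [h2]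
  simp

/-- Fixing all the points but one, an orientation of the configuration space orients the
manifold. -/
theorem ConfOrientation.isOrientableManifold [ChartedSpace (EuclideanSpace ℝ (Fin d)) M]
    (S : ConfOrientation M n d) (hd : 2 ≤ d) (i₀ : Fin n) {q : Fin n → M}
    (hq : Function.Injective q) : IsOrientableManifold d M := by
  set Q : Set M := q '' {i | i ≠ i₀} with hQ
  have hQf : Q.Finite := (toFinite _).image q
  -- The sign of φ at x is that of the configuration in which the point with index `i₀` is moved to
  -- x and the others stay put; it is meaningful only for x outside the finite set Q of the others.
  set T : OpenPartialHomeomorph M (EuclideanSpace ℝ (Fin d)) → M → ℤ := fun φ x =>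
    S.sgn (Function.update (fun i => chartAt _ (q i)) i₀ φ) (Function.update q i₀ x) with hT
  have hinj : ∀ x ∉ Q, Function.Injective (Function.update q i₀ x) := by
    intro x hx i j hij
    by_contra hne
    rcases eq_or_ne i i₀ with rfl | hi
    · rw [Function.update_self, Function.update_of_ne (Ne.symm hne)] at hij
      exact hx ⟨j, Ne.symm hne, hij.symm⟩
    · rcases eq_or_ne j i₀ with rfl | hj
      · rw [Function.update_self, Function.update_of_ne hne] at hij
        exact hx ⟨i, hne, hij⟩
      · rw [Function.update_of_ne hi, Function.update_of_ne hj] at hij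
        exact hne (hq hij)
  have hsrc : ∀ (φ : OpenPartialHomeomorph M (EuclideanSpace ℝ (Fin d))) x, x ∈ φ.source → ∀ i,
      Function.update q i₀ x i ∈
        (Function.update (fun i => chartAt (EuclideanSpace ℝ (Fin d)) (q i)) i₀ φ i).source := by
    intro φ x hx i
    rcases eq_or_ne i i₀ with rfl | hi
    · simpa using hx
    · simp [Function.update_of_ne hi]
  have hself : ∀ (φ : OpenPartialHomeomorph M (EuclideanSpace ℝ (Fin d))) x, x ∈ φ.source →
      transitionDegree φ φ x = 1 := by
    intro φ x hx
    have hid : φ ∘ φ.symm =ᶠ[𝓝 (φ x)] id := by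
      filter_upwards [φ.open_target.mem_nhds (φ.map_source hx)] with v hv
      exact φ.right_inv hv
    rw [transitionDegree, localDegree_congr (isLocalHomeoGerm_id _) hid, localDegree_id]
  have hchange : ∀ φ ψ : OpenPartialHomeomorph M (EuclideanSpace ℝ (Fin d)), ∀ x ∉ Q,
      x ∈ φ.source → x ∈ ψ.source → T φ x = T ψ x * transitionDegree φ ψ x := by
    intro φ ψ x hx hφ hψ
    rw [hT]
    simp only
    rw [S.change _ _ _ (hsrc φ x hφ) (hsrc ψ x hψ) (hinj x hx)]
    congr 1
    rw [Finset.prod_eq_single i₀]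
    · simp
    · intro i _ hi
      simp only [Function.update_of_ne hi]
      exact hself _ _ (mem_chart_source _ _)
    · simp
  have hor : ∀ φ, ∀ x ∉ Q, x ∈ φ.source → T φ x = 1 ∨ T φ x = -1 := fun φ x hx hφ =>
    S.eq_or _ _ (hsrc φ x hφ) (hinj x hx)
  have hloc : ∀ φ, ∀ x ∉ Q, x ∈ φ.source → ∀ᶠ y in 𝓝 x, T φ y = T φ x := by
    intro φ x hx hφ
    have hcont : Continuous fun y : M => Function.update q i₀ y :=
      continuous_const.update i₀ continuous_id
    exact (hcont.continuousAt (x := x)).eventually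
      (S.eventually_eq _ _ (hsrc φ x hφ) (hinj x hx))
  rw [isOrientableManifold_iff]
  have hnontriv : Nontrivial (EuclideanSpace ℝ (Fin d)) := by
    have := one_lt_rank_euclideanSpace hd
    exact rank_pos_iff_nontrivial.1 (zero_lt_one.trans this)
  refine ⟨{φ | ∀ x ∉ Q, x ∈ φ.source → T φ x = 1}, fun x₀ => ?_, fun φ hφ ψ hψ x hxφ hxψ => ?_⟩
  -- The chart meets Q at most at its centre x₀. Its domain minus Q is then a copy of ℝᵈ or of ℝᵈ
  -- without the origin, connected as d ≥ 2, so the sign is constant there and a reflection can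
  -- correct it to +1.
  · obtain ⟨φ, hxφ, hφO, hφt, hφ0⟩ := exists_chart_target_univ (d := d) x₀
      (hQf.subset (sdiff_subset (t := {x₀}))).isClosed.isOpen_compl (by simp)
    have hsymm : Continuous φ.symm := by
      rw [← continuousOn_univ, ← hφt]
      exact φ.continuousOn_symm
    have hms : ∀ v, φ.symm v ∈ φ.source := fun v => φ.map_target (by simp [hφt])
    have hQ0 : ∀ v ≠ 0, φ.symm v ∉ Q := by
      intro v hv hvQ
      refine hφO (hms v) ⟨hvQ, fun h => hv ?_⟩
      rw [mem_singleton_iff] at h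
      rw [← hφ0, ← h, φ.right_inv (by simp [hφt])]
    have hpre : IsPreconnected {v | φ.symm v ∉ Q} := by
      by_cases h0 : φ.symm 0 ∈ Q
      · have : {v | φ.symm v ∉ Q} = {0}ᶜ := by
          ext v
          simp only [mem_ofPred_eq, mem_compl_iff, mem_singleton_iff]
          exact ⟨fun h hv => h (hv ▸ h0), hQ0 v⟩
        rw [this]
        exact (isConnected_compl_singleton_of_one_lt_rank (one_lt_rank_euclideanSpace hd)
          0).isPreconnected
      · have : {v | φ.symm v ∉ Q} = univ := by
          refine eq_univ_of_forall fun v => ?_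
          rcases eq_or_ne v 0 with rfl | hv
          · exact h0
          · exact hQ0 v hv
        rw [this]
        exact isPreconnected_univ
    have hcont : ContinuousOn (fun v => T φ (φ.symm v)) {v | φ.symm v ∉ Q} := by
      intro v hv
      refine ContinuousAt.continuousWithinAt ?_
      exact continuousAt_const.congr (((hsymm.continuousAt (x := v)).eventually
        (hloc φ _ hv (hms v))).mono fun _ h => h.symm)
    obtain ⟨v₀, hv₀⟩ := exists_ne (0 : EuclideanSpace ℝ (Fin d))
    have hcst : ∀ x ∉ Q, x ∈ φ.source → T φ x = T φ (φ.symm v₀) := by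
      intro x hx hxs
      have := hpre.constant hcont (x := φ x) (y := v₀)
        (by rw [mem_ofPred_eq, φ.left_inv hxs]; exact hx) (hQ0 v₀ hv₀)
      simpa only [φ.left_inv hxs] using this
    rcases hor φ _ (hQ0 v₀ hv₀) (hms v₀) with h1 | h1
    · exact ⟨φ, fun x hx hxs => (hcst x hx hxs).trans h1, hxφ⟩
    · obtain ⟨ρ, hρ⟩ := exists_continuousLinearEquiv_det_neg hd
      set φ' := φ.trans ρ.toHomeomorph.toOpenPartialHomeomorph with hφ'
      have hs' : φ'.source = φ.source := by simp [hφ']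
      refine ⟨φ', fun x hx hxs => ?_, hs' ▸ hxφ⟩
      have hxs' : x ∈ φ.source := hs' ▸ hxs
      have ht : transitionDegree φ φ' x = -1 := by
        have he : φ' ∘ φ.symm =ᶠ[𝓝 (φ x)] ρ := by
          filter_upwards [φ.open_target.mem_nhds (φ.map_source hxs')] with v hv
          exact congrArg ρ (φ.right_inv hv)
        rw [transitionDegree, localDegree_congr (ρ.toHomeomorph.isLocalHomeoGerm _) he]
        exact hρ _
      have h2 := hchange φ φ' x hx hxs' hxs
      rw [ht, hcst x hx hxs', h1] at h2
      linarith
  · have hoff : ∀ y ∉ Q, y ∈ φ.source → y ∈ ψ.source → transitionDegree φ ψ y = 1 := by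
      intro y hy hyφ hyψ
      have := hchange φ ψ y hy hyφ hyψ
      rw [hφ y hy hyφ, hψ y hy hyψ, one_mul] at this
      exact this.symm
    -- At a point of Q the sign T gives no information. But the transition degree is locally
    -- constant, and x is a limit of points outside Q, where the degree is already known to be 1.
    have hne : (𝓝[≠] (φ x)).NeBot := inferInstance
    have htend : Tendsto φ.symm (𝓝[≠] (φ x)) (𝓝[≠] x) := by
      have := (φ.symm.isLocalHomeoGerm (φ.map_source hxφ)).tendsto_nhdsNE
      rwa [φ.left_inv hxφ] at this
    have hneM : (𝓝[≠] x).NeBot := hne.map φ.symm |>.mono htend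
    have hev : ∀ᶠ y in 𝓝[≠] x, transitionDegree φ ψ x = 1 := by
      have h1 : ∀ᶠ y in 𝓝[≠] x, y ∉ Q := by
        rw [eventually_nhdsWithin_iff]
        filter_upwards [(hQf.subset (sdiff_subset (t := {x}))).isClosed.isOpen_compl.mem_nhds
          (show x ∈ (Q \ {x})ᶜ by simp)] with y hy hyx hyQ
        exact hy ⟨hyQ, hyx⟩
      filter_upwards [h1, nhdsWithin_le_nhds (φ.open_source.mem_nhds hxφ),
        nhdsWithin_le_nhds (ψ.open_source.mem_nhds hxψ),
        nhdsWithin_le_nhds (eventually_transitionDegree_eq hxφ hxψ)] with y hy hyφ hyψ hyt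
      rw [← hyt]
      exact hoff y hy hyφ hyψ
    exact hev.exists.choose_spec

end FromBraidSpace

theorem lemma2p5 (d n : ℕ) (hd : 2 ≤ d) (hn : 2 ≤ n)
    (M : Type*) [TopologicalSpace M] [T2Space M] [ConnectedSpace M]
    [ChartedSpace (EuclideanSpace ℝ (Fin d)) M] :
    IsOrientableManifold (n * d) (BraidSpace M n) ↔ (IsOrientableManifold d M ∧ Even d) := by
  refine ⟨fun h => ?_, fun h => h.1.braidSpace h.2⟩
  obtain ⟨x₀⟩ := (inferInstance : Nonempty M)
  obtain ⟨φ, -, -, hφ, -⟩ := exists_chart_target_univ (d := d) x₀ isOpen_univ (mem_univ x₀)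
  set a : EuclideanSpace ℝ (Fin d) := EuclideanSpace.single ⟨0, by omega⟩ 1 with ha_def
  have ha : ‖a‖ = 1 := by simp [ha_def]
  -- A chart onto ℝᵈ supplies n distinct points of M: the base point needed for `toBraid`, and the
  -- frozen points used to orient M.
  have hq : Function.Injective fun i => φ.symm (antipodalConf n a a i) := by
    intro i j hij
    exact antipodalConf_injective ha ha (φ.symm.injOn (by simp [hφ]) (by simp [hφ]) hij)
  obtain ⟨S⟩ := h.nonempty_confOrientation (BraidSpace.mk ⟨_, hq⟩)
  exact ⟨S.isOrientableManifold hd ⟨0, by omega⟩ hq, S.even hd hn hφ⟩
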